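/- A \emph{Wang tile} is a unit square with colored edges, written as a tuple $(a,b,c,d)$ of its right, top, left and bottom colors. For a finite set $\mathcal{T}$ of Wang tiles, the \emph{Wang shift} $\Omega_{\mathcal{T}}\subset\mathcal{T}^{\mathbb{Z}^2}$ is the set of all maps $x:\mathbb{Z}^2\to\mathcal{T}$ such that, for every $\mathbf{n}\in\mathbb{Z}^2$, the right color of $x(\mathbf{n})$ equals the left color of $x(\mathbf{n}+(1,0))$ and the top color of $x(\mathbf{n})$ equals the bottom color of $x(\mathbf{n}+(0,1))$. The group $\mathbb{Z}^2$ acts on $\mathcal{T}^{\mathbb{Z}^2}$ by the shift $(\sigma^{\mathbf{n}}x)(\mathbf{m})=x(\mathbf{m}+\mathbf{n})$, and $\mathcal{T}^{\mathbb{Z}^2}$ carries the product of the discrete topologies. A \emph{subshift} is a closed subset $X\subset\mathcal{T}^{\mathbb{Z}^2}$ that is shift-invariant, i.e. $\sigma^{\mathbf{n}}(X)=X$ for every $\mathbf{n}\in\mathbb{Z}^2$. A subshift $X$ is \emph{minimal} if it contains no nonempty, proper, closed, shift-invariant subset, and it is \emph{aperiodic} if it is nonempty and no $x\in X$ satisfies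 $\sigma^{\mathbf{n}}x=x$ for some $\mathbf{n}\in\mathbb{Z}^2\setminus\{(0,0)\}$. Let $\mathcal{T}_5,\dots,\mathcal{T}_{12}$ be the following sets of Wang tiles $(\text{right},\text{top},\text{left},\text{bottom})$, whose colors are words over the digits $0,\dots,9$ (they are the sets of tiles, introduced in the study of the substitutive structure of the Jeandel--Rao aperiodic tilings, of cardinalities $29,29,20,20,22,18,21,19$): $\mathcal{T}_{5}=\{(2113,5,2130,1),\ (2130,1,2103,5),\ (2133,1,2113,1),\ (2113,5,2330,0),\ (2130,6,2300,0),\ (2103,5,2310,0),\ (2310,1,2033,6),\ (2300,1,2033,6),\ (2300,0,2030,6),\ (2030,1,2103,0),\ (2033,1,2113,0),\ (2330,1,2133,6),\ (2330,0,2130,6),\ (21113,5,21330,1),\ (21130,6,21300,1),\ (21103,5,21310,1),\ (21310,1,21033,5),\ (21310,0,21030,5),\ (21300,1,21033,5),\ (21300,0,21030,5),\ (21030,1,21103,1),\ (21033,1,21113,1),\ (21330,0,21130,1),\ (21330,0,21130,5),\ (21130,6,23300,0),\ (21030,6,23100,0),\ (23100,0,20330,6),\ (20330,0,21130,0),\ (23300,0,21330,6)\}$.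 $\mathcal{T}_{6}=\{(21131,1,21305,1),\ (21305,5,21031,5),\ (21331,1,21131,1),\ (21131,1,23305,0),\ (21300,0,23006,0),\ (21031,1,23105,0),\ (23105,5,20331,6),\ (23006,6,20331,6),\ (23006,6,20300,6),\ (20300,0,21031,0),\ (20331,1,21131,0),\ (23305,5,21331,6),\ (23305,5,21300,6),\ (211131,1,213305,1),\ (211300,0,213006,1),\ (211031,1,213105,1),\ (213105,5,210331,5),\ (213105,5,210300,5),\ (213006,6,210331,5),\ (213006,6,210300,5),\ (210300,0,211031,1),\ (210331,1,211131,1),\ (213300,0,211300,1),\ (213305,5,211300,5),\ (211300,0,233006,0),\ (210300,0,231006,0),\ (231006,6,203300,6),\ (203300,0,211300,0),\ (233006,6,213300,6)\}$. $\mathcal{T}_{7}=\{(21331,1,21131,1),\ (20300,0,21031,0),\ (20331,1,21131,0),\ (210300,0,211031,1),\ (210331,1,211131,1),\ (213300,0,211300,1),\ (203300,0,211300,0),\ (21131,51,21031,51),\ (21031,51,20331,60),\ (21300,60,20331,60),\ (21300,60,20300,60),\ (21131,51,21331,60),\ (21131,51,21300,60),\ (211031,51,210331,51),\ (211031,51,210300,51),\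 (211300,60,210331,51),\ (211300,60,210300,51),\ (211131,51,211300,51),\ (210300,60,203300,60),\ (211300,60,213300,60)\}$. $\mathcal{T}_{8}=\{(21031,51,20331,60),\ (21300,60,20331,60),\ (21300,60,20300,60),\ (211300,60,210331,51),\ (211300,60,210300,51),\ (210300,60,203300,60),\ (211300,60,213300,60),\ (21331,511,21031,511),\ (20331,511,21031,510),\ (20300,510,20331,600),\ (20331,511,21331,600),\ (20331,511,21300,600),\ (210300,510,210331,511),\ (210300,510,210300,511),\ (213300,600,210331,511),\ (203300,600,210331,510),\ (213300,600,210300,511),\ (203300,600,210300,510),\ (210331,511,211300,511),\ (203300,600,213300,600)\}$. $\mathcal{T}_{9}=\{(211300,60,210331,51),\ (211300,60,210300,51),\ (210300,60,203300,60),\ (211300,60,213300,60),\ (210300,510,210331,511),\ (210300,510,210300,511),\ (213300,600,210331,511),\ (203300,600,210331,510),\ (210331,511,211300,511),\ (21130021031,51,21030020331,51),\ (21030021031,51,20330020331,60),\ (21030021300,60,20330020331,60),\ (21030021300,60,20330020300,60),\ (21130021031,51,21330020331,60),\ (21030020331,511,21030021031,511),\ (21330020331,511,21033121331,511),\ (20330020331,511,21033121331,510),\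 (21330020331,511,21030021300,511),\ (20330020300,510,21030020331,510),\ (20330020331,511,21030021300,510),\ (21033121331,511,21130021031,511),\ (20330020300,510,21330020331,600)\}$. $\mathcal{T}_{10}=\{(210331,511,211300,511),\ (21030020331,511,21030021031,511),\ (21330020331,511,21030021300,511),\ (21033121331,511,21130021031,511),\ (211300,51060,210331,51151),\ (211300,51060,210300,51151),\ (211300,60060,210331,51160),\ (210300,60060,210331,51060),\ (211300,51160,211300,51151),\ (21130021031,51151,21030021031,51151),\ (21130021031,51151,21033121331,51160),\ (21030021031,51151,21033121331,51060),\ (21030021300,51160,21033121331,51060),\ (21130021031,51151,21030021300,51160),\ (21030021300,51060,21030020331,51060),\ (21030021031,51151,21030021300,51060),\ (21030021300,51160,21030021300,51060),\ (21030021300,51060,21330020331,60060)\}$. $\mathcal{T}_{11}=\{(21030020331,511,21030021031,511),\ (21330020331,511,21030021300,511),\ (21033121331,511,21130021031,511),\ (21030021300,51160,21033121331,51060),\ (21130021031,51151,21030021300,51160),\ (21030021300,51060,21030020331,51060),\ (21030021031,51151,21030021300,51060),\ (21030021300,51160,21030021300,51060),\ (21030021300,51060,21330020331,60060),\ (21030020331210331,511,21030021031211300,511),\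 (21330020331210331,511,21030021300211300,511),\ (21033121331210331,511,21130021031211300,511),\ (21130021031211300,51160,21030021031211300,51151),\ (21130021031211300,51060,21033121331210331,51160),\ (21030021031211300,51060,21033121331210331,51060),\ (21030021300211300,60060,21033121331210331,51060),\ (21130021031211300,51060,21030021300210300,51160),\ (21130021031211300,51160,21030021300211300,51160),\ (21030021300210300,60060,21030020331210331,51060),\ (21030021031211300,51060,21030021300210300,51060),\ (21030021300210300,60060,21330020331210331,60060)\}$. $\mathcal{T}_{12}=\{(21030021300,51060,21030020331,51060),\ (21030021300,51060,21330020331,60060),\ (21030021031211300,51060,21033121331210331,51060),\ (21030021300211300,60060,21033121331210331,51060),\ (21030021300210300,60060,21030020331210331,51060),\ (21030021300210300,60060,21330020331210331,60060),\ (21330020331,51160511,21033121331,51060511),\ (21033121331,51151511,21030021300,51160511),\ (21330020331,51060511,21030020331,51060511),\ (21030020331,51151511,21030021300,51060511),\ (21330020331,51160511,21030021300,51060511),\ (21330020331,51060511,21330020331,60060511),\ (21033121331210331,51160511,21030021031211300,51151511),\ (21033121331210331,51060511,21033121331210331,51160511),\ (21030020331210331,51060511,21033121331210331,51060511),\ (21330020331210331,60060511,21033121331210331,51060511),\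 (21033121331210331,51060511,21030021300210300,51160511),\ (21033121331210331,51160511,21030021300211300,51160511),\ (21030020331210331,51060511,21030021300210300,51060511)\}$. For $5\le i\le 12$ let $\Omega_i=\Omega_{\mathcal{T}_i}$ be the Wang shift of $\mathcal{T}_i$. Then, for every $i$ with $5\le i\le 12$, the Wang shift $\Omega_i$ is aperiodic and minimal. -/

import Mathlib

/-! ## Configurations over `ℤ²`, the shift action, subshifts -/

/-- The full shift `A^(ℤ²)`; for a discrete alphabet `A` it carries the product topology. -/
abbrev Configuration (A : Type*) : Type _ := ℤ × ℤ → A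

/-- The shift action `(σⁿ x)ₘ = x_{m+n}` of `ℤ²`. -/
def shift {A : Type*} (n : ℤ × ℤ) (x : Configuration A) : Configuration A :=
  fun m => x (m + n)

/-- `X` is shift-invariant: `σⁿ(X) = X` for every `n ∈ ℤ²`. -/
def IsShiftInvariant {A : Type*} (X : Set (Configuration A)) : Prop :=
  ∀ n : ℤ × ℤ, shift n '' X = X

/-- A subshift is a closed shift-invariant set of configurations. -/
def IsSubshift {A : Type*} [TopologicalSpace A] (X : Set (Configuration A)) : Prop :=
  IsClosed X ∧ IsShiftInvariant X

/-- A subshift is minimal if it contains no nonempty proper closed shift-invariant subset. -/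
def IsMinimalSubshift {A : Type*} [TopologicalSpace A] (X : Set (Configuration A)) : Prop :=
  IsSubshift X ∧
    ¬ ∃ Y : Set (Configuration A), Y.Nonempty ∧ Y ⊂ X ∧ IsClosed Y ∧ IsShiftInvariant Y

/-- A configuration is periodic if it has a nonzero period. -/
def IsPeriodic {A : Type*} (x : Configuration A) : Prop :=
  ∃ n : ℤ × ℤ, n ≠ 0 ∧ shift n x = x

/-- A set of configurations is aperiodic if it is nonempty and all its elements are
nonperiodic. -/
def IsAperiodic {A : Type*} (X : Set (Configuration A)) : Prop :=
  X.Nonempty ∧ ∀ x ∈ X, ¬ IsPeriodic x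

/-! ## Wang tiles and Wang shifts -/

/-- A Wang tile with vertical colors in `I` (right and left edges) and horizontal colors in `J`
(top and bottom edges), written as the tuple (right, top, left, bottom). -/
structure WangTile (I J : Type*) where
  right : I
  top : J
  left : I
  bottom : J
deriving DecidableEq

/-- Sets of tiles are used as alphabets, with the discrete topology. -/
instance WangTile.instTopologicalSpace (I J : Type*) : TopologicalSpace (WangTile I J) := ⊥

instance WangTile.instDiscreteTopology (I J : Type*) : DiscreteTopology (WangTile I J) := ⟨rfl⟩

/-- The Wang shift `Ω_T ⊆ T^(ℤ²)` of a finite set `T` of Wang tiles: the set of all valid tilings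
of `ℤ²` by `T`, in which contiguous edges have the same color. -/
def wangShift {I J : Type*} (T : Finset (WangTile I J)) : Set (Configuration T) :=
  {x | ∀ n : ℤ × ℤ,
    (x n).1.right = (x (n + (1, 0))).1.left ∧ (x n).1.top = (x (n + (0, 1))).1.bottom}

/-! ## The sets of Wang tiles `T₅, …, T₁₂`

A tile is listed as ⟨right, top, left, bottom⟩. A color is a nonempty word over the digits, none
of which of length at least two begins with `0`; it is written as the decimal numeral with these
digits. -/

/-- The set `T_5` of 29 Wang tiles. -/
def tiles5 : Finset (WangTile ℕ ℕ) := {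
  ⟨2113, 5, 2130, 1⟩, ⟨2130, 1, 2103, 5⟩, ⟨2133, 1, 2113, 1⟩, ⟨2113, 5, 2330, 0⟩,
  ⟨2130, 6, 2300, 0⟩, ⟨2103, 5, 2310, 0⟩, ⟨2310, 1, 2033, 6⟩, ⟨2300, 1, 2033, 6⟩,
  ⟨2300, 0, 2030, 6⟩, ⟨2030, 1, 2103, 0⟩, ⟨2033, 1, 2113, 0⟩, ⟨2330, 1, 2133, 6⟩,
  ⟨2330, 0, 2130, 6⟩, ⟨21113, 5, 21330, 1⟩, ⟨21130, 6, 21300, 1⟩, ⟨21103, 5, 21310, 1⟩,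
  ⟨21310, 1, 21033, 5⟩, ⟨21310, 0, 21030, 5⟩, ⟨21300, 1, 21033, 5⟩, ⟨21300, 0, 21030, 5⟩,
  ⟨21030, 1, 21103, 1⟩, ⟨21033, 1, 21113, 1⟩, ⟨21330, 0, 21130, 1⟩, ⟨21330, 0, 21130, 5⟩,
  ⟨21130, 6, 23300, 0⟩, ⟨21030, 6, 23100, 0⟩, ⟨23100, 0, 20330, 6⟩, ⟨20330, 0, 21130, 0⟩,
  ⟨23300, 0, 21330, 6⟩}

/-- The set `T_6` of 29 Wang tiles. -/
def tiles6 : Finset (WangTile ℕ ℕ) := {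
  ⟨21131, 1, 21305, 1⟩, ⟨21305, 5, 21031, 5⟩, ⟨21331, 1, 21131, 1⟩, ⟨21131, 1, 23305, 0⟩,
  ⟨21300, 0, 23006, 0⟩, ⟨21031, 1, 23105, 0⟩, ⟨23105, 5, 20331, 6⟩, ⟨23006, 6, 20331, 6⟩,
  ⟨23006, 6, 20300, 6⟩, ⟨20300, 0, 21031, 0⟩, ⟨20331, 1, 21131, 0⟩, ⟨23305, 5, 21331, 6⟩,
  ⟨23305, 5, 21300, 6⟩, ⟨211131, 1, 213305, 1⟩, ⟨211300, 0, 213006, 1⟩, ⟨211031, 1, 213105, 1⟩,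
  ⟨213105, 5, 210331, 5⟩, ⟨213105, 5, 210300, 5⟩, ⟨213006, 6, 210331, 5⟩, ⟨213006, 6, 210300, 5⟩,
  ⟨210300, 0, 211031, 1⟩, ⟨210331, 1, 211131, 1⟩, ⟨213300, 0, 211300, 1⟩, ⟨213305, 5, 211300, 5⟩,
  ⟨211300, 0, 233006, 0⟩, ⟨210300, 0, 231006, 0⟩, ⟨231006, 6, 203300, 6⟩, ⟨203300, 0, 211300, 0⟩,
  ⟨233006, 6, 213300, 6⟩}

/-- The set `T_7` of 20 Wang tiles. -/
def tiles7 : Finset (WangTile ℕ ℕ) := {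
  ⟨21331, 1, 21131, 1⟩, ⟨20300, 0, 21031, 0⟩, ⟨20331, 1, 21131, 0⟩, ⟨210300, 0, 211031, 1⟩,
  ⟨210331, 1, 211131, 1⟩, ⟨213300, 0, 211300, 1⟩, ⟨203300, 0, 211300, 0⟩, ⟨21131, 51, 21031, 51⟩,
  ⟨21031, 51, 20331, 60⟩, ⟨21300, 60, 20331, 60⟩, ⟨21300, 60, 20300, 60⟩, ⟨21131, 51, 21331, 60⟩,
  ⟨21131, 51, 21300, 60⟩, ⟨211031, 51, 210331, 51⟩, ⟨211031, 51, 210300, 51⟩,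
  ⟨211300, 60, 210331, 51⟩, ⟨211300, 60, 210300, 51⟩, ⟨211131, 51, 211300, 51⟩,
  ⟨210300, 60, 203300, 60⟩, ⟨211300, 60, 213300, 60⟩}

/-- The set `T_8` of 20 Wang tiles. -/
def tiles8 : Finset (WangTile ℕ ℕ) := {
  ⟨21031, 51, 20331, 60⟩, ⟨21300, 60, 20331, 60⟩, ⟨21300, 60, 20300, 60⟩,
  ⟨211300, 60, 210331, 51⟩, ⟨211300, 60, 210300, 51⟩, ⟨210300, 60, 203300, 60⟩,
  ⟨211300, 60, 213300, 60⟩, ⟨21331, 511, 21031, 511⟩, ⟨20331, 511, 21031, 510⟩,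
  ⟨20300, 510, 20331, 600⟩, ⟨20331, 511, 21331, 600⟩, ⟨20331, 511, 21300, 600⟩,
  ⟨210300, 510, 210331, 511⟩, ⟨210300, 510, 210300, 511⟩, ⟨213300, 600, 210331, 511⟩,
  ⟨203300, 600, 210331, 510⟩, ⟨213300, 600, 210300, 511⟩, ⟨203300, 600, 210300, 510⟩,
  ⟨210331, 511, 211300, 511⟩, ⟨203300, 600, 213300, 600⟩}

/-- The set `T_9` of 22 Wang tiles. -/
def tiles9 : Finset (WangTile ℕ ℕ) := {
  ⟨211300, 60, 210331, 51⟩, ⟨211300, 60, 210300, 51⟩, ⟨210300, 60, 203300, 60⟩,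
  ⟨211300, 60, 213300, 60⟩, ⟨210300, 510, 210331, 511⟩, ⟨210300, 510, 210300, 511⟩,
  ⟨213300, 600, 210331, 511⟩, ⟨203300, 600, 210331, 510⟩, ⟨210331, 511, 211300, 511⟩,
  ⟨21130021031, 51, 21030020331, 51⟩, ⟨21030021031, 51, 20330020331, 60⟩,
  ⟨21030021300, 60, 20330020331, 60⟩, ⟨21030021300, 60, 20330020300, 60⟩,
  ⟨21130021031, 51, 21330020331, 60⟩, ⟨21030020331, 511, 21030021031, 511⟩,
  ⟨21330020331, 511, 21033121331, 511⟩, ⟨20330020331, 511, 21033121331, 510⟩,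
  ⟨21330020331, 511, 21030021300, 511⟩, ⟨20330020300, 510, 21030020331, 510⟩,
  ⟨20330020331, 511, 21030021300, 510⟩, ⟨21033121331, 511, 21130021031, 511⟩,
  ⟨20330020300, 510, 21330020331, 600⟩}

/-- The set `T_10` of 18 Wang tiles. -/
def tiles10 : Finset (WangTile ℕ ℕ) := {
  ⟨210331, 511, 211300, 511⟩, ⟨21030020331, 511, 21030021031, 511⟩,
  ⟨21330020331, 511, 21030021300, 511⟩, ⟨21033121331, 511, 21130021031, 511⟩,
  ⟨211300, 51060, 210331, 51151⟩, ⟨211300, 51060, 210300, 51151⟩, ⟨211300, 60060, 210331, 51160⟩,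
  ⟨210300, 60060, 210331, 51060⟩, ⟨211300, 51160, 211300, 51151⟩,
  ⟨21130021031, 51151, 21030021031, 51151⟩, ⟨21130021031, 51151, 21033121331, 51160⟩,
  ⟨21030021031, 51151, 21033121331, 51060⟩, ⟨21030021300, 51160, 21033121331, 51060⟩,
  ⟨21130021031, 51151, 21030021300, 51160⟩, ⟨21030021300, 51060, 21030020331, 51060⟩,
  ⟨21030021031, 51151, 21030021300, 51060⟩, ⟨21030021300, 51160, 21030021300, 51060⟩,
  ⟨21030021300, 51060, 21330020331, 60060⟩}

/-- The set `T_11` of 21 Wang tiles. -/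
def tiles11 : Finset (WangTile ℕ ℕ) := {
  ⟨21030020331, 511, 21030021031, 511⟩, ⟨21330020331, 511, 21030021300, 511⟩,
  ⟨21033121331, 511, 21130021031, 511⟩, ⟨21030021300, 51160, 21033121331, 51060⟩,
  ⟨21130021031, 51151, 21030021300, 51160⟩, ⟨21030021300, 51060, 21030020331, 51060⟩,
  ⟨21030021031, 51151, 21030021300, 51060⟩, ⟨21030021300, 51160, 21030021300, 51060⟩,
  ⟨21030021300, 51060, 21330020331, 60060⟩, ⟨21030020331210331, 511, 21030021031211300, 511⟩,
  ⟨21330020331210331, 511, 21030021300211300, 511⟩,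
  ⟨21033121331210331, 511, 21130021031211300, 511⟩,
  ⟨21130021031211300, 51160, 21030021031211300, 51151⟩,
  ⟨21130021031211300, 51060, 21033121331210331, 51160⟩,
  ⟨21030021031211300, 51060, 21033121331210331, 51060⟩,
  ⟨21030021300211300, 60060, 21033121331210331, 51060⟩,
  ⟨21130021031211300, 51060, 21030021300210300, 51160⟩,
  ⟨21130021031211300, 51160, 21030021300211300, 51160⟩,
  ⟨21030021300210300, 60060, 21030020331210331, 51060⟩,
  ⟨21030021031211300, 51060, 21030021300210300, 51060⟩,
  ⟨21030021300210300, 60060, 21330020331210331, 60060⟩}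

/-- The set `T_12` of 19 Wang tiles. -/
def tiles12 : Finset (WangTile ℕ ℕ) := {
  ⟨21030021300, 51060, 21030020331, 51060⟩, ⟨21030021300, 51060, 21330020331, 60060⟩,
  ⟨21030021031211300, 51060, 21033121331210331, 51060⟩,
  ⟨21030021300211300, 60060, 21033121331210331, 51060⟩,
  ⟨21030021300210300, 60060, 21030020331210331, 51060⟩,
  ⟨21030021300210300, 60060, 21330020331210331, 60060⟩,
  ⟨21330020331, 51160511, 21033121331, 51060511⟩, ⟨21033121331, 51151511, 21030021300, 51160511⟩,
  ⟨21330020331, 51060511, 21030020331, 51060511⟩, ⟨21030020331, 51151511, 21030021300, 51060511⟩,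
  ⟨21330020331, 51160511, 21030021300, 51060511⟩, ⟨21330020331, 51060511, 21330020331, 60060511⟩,
  ⟨21033121331210331, 51160511, 21030021031211300, 51151511⟩,
  ⟨21033121331210331, 51060511, 21033121331210331, 51160511⟩,
  ⟨21030020331210331, 51060511, 21033121331210331, 51060511⟩,
  ⟨21330020331210331, 60060511, 21033121331210331, 51060511⟩,
  ⟨21033121331210331, 51060511, 21030021300210300, 51160511⟩,
  ⟨21033121331210331, 51160511, 21030021300211300, 51160511⟩,
  ⟨21030020331210331, 51060511, 21030021300210300, 51060511⟩}

/-- The set of Wang tiles `T_i` for `5 ≤ i ≤ 12`; the value at any other index is irrelevant. -/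
def tileSet : ℕ → Finset (WangTile ℕ ℕ)
  | 5 => tiles5
  | 6 => tiles6
  | 7 => tiles7
  | 8 => tiles8
  | 9 => tiles9
  | 10 => tiles10
  | 11 => tiles11
  | 12 => tiles12
  | _ => ∅

/-! ## Integer sequences with positive increments -/

/-! The eight Wang shifts are linked by maps that transport nonemptiness, absence of periods and
uniform occurrence of patterns, and the last one, given by `tiles12`, is self-similar.

The basic link is fusion along markers (`IsFusion.desubstitutes`). If a set of tiles always fills
whole columns, no two of them adjacent, then each marked column can be glued to the column on its
left. The tiling then becomes one by fused tiles, from which it is recovered by a substitution. The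
gluing is canonical, so periods pass to the fused tiling. Rows are treated by reflection. This leads
from `tiles6` to `tiles12`; between `tiles5` and `tiles6` there is only a shear of the plane.

Fusing rows and then columns once more brings tilings by `tiles12` to tilings by `tileList13` and
back to tilings by `tiles12`, up to the names of the colors. Hence `expansion12` desubstitutes this
class into itself, and three properties follow. Aperiodicity (`NoPeriods.of_selfSimilar`): a nonzero
period of a tiling yields a strictly shorter one of its preimage, because two consecutive columns or
rows are never both replaced by single ones; this is an infinite descent. Minimality
(`UniformLanguage.of_selfSimilar`): large patterns lie in images of smaller ones, which reduces the
claim to `2 × 2` patterns. A finite computation shows that the iterated image of any admissible `2 ×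
2` pattern contains all the others. If every pattern of one tiling occurs in every other, then all
orbits are dense. Existence (`nonempty_of_selfSimilar`): iterated images of one letter tile
arbitrarily large squares, and compactness gives a tiling of the plane.

The remaining hypotheses are finite. They are decided on tables of dominoes from which dominoes
without neighbours have been pruned; this never removes a domino of a tiling of the plane. -/

theorem le_of_increments {P : ℤ → ℤ} (hP : ∀ i, P i + 1 ≤ P (i + 1)) {i j : ℤ} (h : i ≤ j) :
    P i + (j - i) ≤ P j := by
  induction j, h using Int.leInduction with
  | base => simp
  | succ k _ ih => have := hP k; omega

theorem exists_increments_cover {P : ℤ → ℤ} (hP : ∀ i, P i + 1 ≤ P (i + 1)) (m : ℤ) :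
    ∃ i, P i ≤ m ∧ m < P (i + 1) := by
  obtain ⟨i, hi, hmax⟩ := Int.exists_greatest_of_bdd (P := fun i => P i ≤ m)
    ⟨max 0 (m - P 0), fun z hz => by
      rcases le_or_gt z 0 with h | h
      · exact le_max_of_le_left h
      · have := le_of_increments hP h.le
        exact le_max_of_le_right (by omega)⟩
    ⟨min 0 (m - P 0), by
      have := le_of_increments hP (min_le_left 0 (m - P 0))
      have := min_le_right 0 (m - P 0)
      omega⟩
  refine ⟨i, hi, ?_⟩
  by_contra h
  have := hmax (i + 1) (by omega)
  omega

theorem increments_cover_unique {P : ℤ → ℤ} (hP : ∀ i, P i + 1 ≤ P (i + 1)) {m i j : ℤ}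
    (hi : P i ≤ m) (hi' : m < P (i + 1)) (hj : P j ≤ m) (hj' : m < P (j + 1)) : i = j := by
  rcases lt_trichotomy i j with h | h | h
  · have := le_of_increments hP (show i + 1 ≤ j by omega); omega
  · exact h
  · have := le_of_increments hP (show j + 1 ≤ i by omega); omega

/-- Recursion in both directions at once: `(i, s) ↦ (i + 1, s + w i)` is a permutation of `ℤ × ℤ`,
and its integer powers applied to `(0, 0)` trace the graph of `P`. -/
theorem exists_seq_of_increments (w : ℤ → ℤ) :
    ∃ P : ℤ → ℤ, P 0 = 0 ∧ ∀ i, P (i + 1) = P i + w i := by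
  let e : (ℤ × ℤ) ≃ (ℤ × ℤ) :=
    { toFun := fun p => (p.1 + 1, p.2 + w p.1)
      invFun := fun p => (p.1 - 1, p.2 - w (p.1 - 1))
      left_inv := fun p => by simp
      right_inv := fun p => by simp }
  have key : ∀ i : ℤ, ((e ^ (i + 1)) (0, 0)) = e ((e ^ i) (0, 0)) := fun i => by
    rw [add_comm, zpow_add, zpow_one, Equiv.Perm.mul_apply]
  have h1 : ∀ i : ℤ, ((e ^ i) (0, 0)).1 = i := by
    intro i
    induction i using Int.induction_on with
    | zero => simp
    | succ i ih => rw [key]; simp [e] at ih ⊢; exact ih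
    | pred i ih =>
      have := key (-(i : ℤ) - 1)
      rw [sub_add_cancel] at this
      rw [this] at ih
      simp only [e, Equiv.coe_fn_mk] at ih
      simp only [e]
      omega
  refine ⟨fun i => ((e ^ i) (0, 0)).2, by simp, fun i => ?_⟩
  have := h1 i
  simp only [key]
  simp only [e, Equiv.coe_fn_mk] at this ⊢
  rw [this]

/-- The complement of a set of isolated integers is enumerated increasingly. -/
theorem exists_enumeration (m : ℤ → Bool) (h : ∀ i, m i = true → m (i + 1) = false) :
    ∃ P : ℤ → ℤ, (∀ i, m (P i) = false) ∧
      (∀ i, P (i + 1) = if m (P i + 1) then P i + 2 else P i + 1) ∧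
      ∀ c, m c = false → ∃ i, P i = c := by
  have hf : ∀ c, m c = false → m (if m (c + 1) then c + 2 else c + 1) = false := by
    intro c _
    split_ifs with h1
    · have := h _ h1; rwa [add_assoc] at this
    · simpa using h1
  have hb : ∀ c, m c = false → m (if m (c - 1) then c - 2 else c - 1) = false := by
    intro c hc
    split_ifs with h1
    · by_contra h2
      have := h (c - 2) (by simpa using h2)
      rw [show c - 2 + 1 = c - 1 by ring, h1] at this
      cases this
    · simpa using h1
  -- Passing to the next unmarked integer is a bijection of the unmarked integers, since a step
  -- skips at most one marked integer; `P` is an orbit of its integer powers.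
  let e : {c // m c = false} ≃ {c // m c = false} :=
    { toFun := fun c => ⟨if m (c.1 + 1) then c.1 + 2 else c.1 + 1, hf c.1 c.2⟩
      invFun := fun c => ⟨if m (c.1 - 1) then c.1 - 2 else c.1 - 1, hb c.1 c.2⟩
      left_inv := by
        rintro ⟨c, hc⟩
        apply Subtype.ext
        dsimp only
        by_cases h1 : m (c + 1) = true
        · simp [h1, show c + 2 - 1 = c + 1 by ring]
        · simp [h1, hc]
      right_inv := by
        rintro ⟨c, hc⟩
        apply Subtype.ext
        dsimp only
        by_cases h1 : m (c - 1) = true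
        · simp [h1, show c - 2 + 1 = c - 1 by ring]
        · simp [h1, hc] }
  obtain ⟨c0, hc0⟩ : ∃ c, m c = false := by
    by_cases h0 : m 0 = true
    · exact ⟨_, h _ h0⟩
    · exact ⟨0, by simpa using h0⟩
  set P : ℤ → ℤ := fun i => ((e ^ i) ⟨c0, hc0⟩).1 with hPdef
  have hstep : ∀ i, P (i + 1) = if m (P i + 1) then P i + 2 else P i + 1 := fun i => by
    simp only [hPdef]
    rw [add_comm, zpow_add, zpow_one, Equiv.Perm.mul_apply]
    rfl
  refine ⟨P, fun i => ((e ^ i) ⟨c0, hc0⟩).2, hstep, fun c hc => ?_⟩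
  obtain ⟨i, hi, hi'⟩ := exists_increments_cover (P := P)
    (fun i => by rw [hstep]; split_ifs <;> omega) c
  refine ⟨i, ?_⟩
  rw [hstep] at hi'
  split_ifs at hi' with h1
  · rcases eq_or_lt_of_le hi with h2 | h2
    · exact h2
    · rw [show c = P i + 1 by omega, h1] at hc
      cases hc
  · omega

/-! ## Planar configurations over an alphabet of natural numbers -/

/-- The configuration `x` is a nearest-neighbour tiling with letters below `n`, horizontal
dominoes in `H` and vertical dominoes in `V`. -/
def IsTiling (n : ℕ) (H V : ℕ → ℕ → Bool) (x : ℤ → ℤ → ℕ) : Prop :=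
  ∀ i j, x i j < n ∧ H (x i j) (x (i + 1) j) = true ∧ V (x i j) (x i (j + 1)) = true

/-- The pattern of `x` on `[a₀,a₁) × [b₀,b₁)` occurs in `x'` translated by `(u,v)`. -/
def Agree (x x' : ℤ → ℤ → ℕ) (u v a₀ a₁ b₀ b₁ : ℤ) : Prop :=
  ∀ i j, a₀ ≤ i → i < a₁ → b₀ ≤ j → j < b₁ → x' (i + u) (j + v) = x i j

/-- Every finite pattern of a configuration in `X` occurs in every configuration in `X`. -/
def UniformLanguage (X : Set (ℤ → ℤ → ℕ)) : Prop :=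
  ∀ x ∈ X, ∀ x' ∈ X, ∀ N : ℕ, ∃ u v, Agree x x' u v (-N) N (-N) N

/-- `(p, q)` is a period of `x`. -/
def HasPeriod (x : ℤ → ℤ → ℕ) (p q : ℤ) : Prop := ∀ i j, x (i + p) (j + q) = x i j

/-- No configuration in `X` has a nonzero period. -/
def NoPeriods (X : Set (ℤ → ℤ → ℕ)) : Prop := ∀ x ∈ X, ∀ p q, HasPeriod x p q → p = 0 ∧ q = 0

/-! ## Two-dimensional substitutions -/

/-- A rule replacing a letter `c` by a rectangular pattern with `w c` columns and `h c` rows, whose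
letter in column `a` and row `b` is `e c a b`. -/
structure Expansion where
  w : ℕ → ℕ
  h : ℕ → ℕ
  e : ℕ → ℕ → ℕ → ℕ

/-- The configuration `x` is obtained from `y` by applying `E`; the image of `y i j` has its lower
left corner at `(P i, Q j)`. -/
structure IsSubst (E : Expansion) (x y : ℤ → ℤ → ℕ) (P Q : ℤ → ℤ) : Prop where
  stepP : ∀ i j, P (i + 1) = P i + E.w (y i j)
  stepQ : ∀ i j, Q (j + 1) = Q j + E.h (y i j)
  val : ∀ i j (a b : ℕ), a < E.w (y i j) → b < E.h (y i j) →
    x (P i + a) (Q j + b) = E.e (y i j) a b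

/-- Every configuration in `X` is the image of one in `Y`, which inherits its periods. -/
def Desubstitutes (E : Expansion) (X Y : Set (ℤ → ℤ → ℕ)) : Prop :=
  ∀ x ∈ X, ∃ y ∈ Y, ∃ P Q, IsSubst E x y P Q ∧ ∀ p q, HasPeriod x p q →
    ∃ p' q', HasPeriod y p' q' ∧ (∀ i, P (i + p') = P i + p) ∧ ∀ j, Q (j + q') = Q j + q

/-- The images of the letters of configurations in `Y` are not empty. -/
def Expansion.PosOn (E : Expansion) (Y : Set (ℤ → ℤ → ℕ)) : Prop :=
  ∀ y ∈ Y, ∀ i j, 1 ≤ E.w (y i j) ∧ 1 ≤ E.h (y i j)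

/-- Reflection in the diagonal. -/
def reflect (X : Set (ℤ → ℤ → ℕ)) : Set (ℤ → ℤ → ℕ) := {x | (fun i j => x j i) ∈ X}

/-- Reflection of an expansion in the diagonal. -/
def Expansion.reflect (E : Expansion) : Expansion := ⟨E.h, E.w, fun c a b => E.e c b a⟩

theorem IsSubst.reflect {E : Expansion} {x y : ℤ → ℤ → ℕ} {P Q : ℤ → ℤ} (h : IsSubst E x y P Q) :
    IsSubst E.reflect (fun i j => x j i) (fun i j => y j i) Q P :=
  ⟨fun i j => h.stepQ j i, fun i j => h.stepP j i, fun i j a b ha hb => h.val j i b a hb ha⟩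

theorem Desubstitutes.reflect {E : Expansion} {X Y : Set (ℤ → ℤ → ℕ)} (h : Desubstitutes E X Y) :
    Desubstitutes E.reflect (reflect X) (_root_.reflect Y) := by
  intro x hx
  obtain ⟨y, hy, P, Q, hs, hp⟩ := h _ hx
  refine ⟨fun i j => y j i, hy, Q, P, hs.reflect, fun p q hpq => ?_⟩
  obtain ⟨p', q', h1, h2, h3⟩ := hp q p (fun i j => hpq j i)
  exact ⟨q', p', fun i j => h1 j i, h3, h2⟩

theorem reflect_isTiling (n : ℕ) (H V : ℕ → ℕ → Bool) :
    reflect {x | IsTiling n V H x} = {x | IsTiling n H V x} := by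
  ext x
  exact ⟨fun h i j => ⟨(h j i).1, (h j i).2.2, (h j i).2.1⟩,
    fun h i j => ⟨(h j i).1, (h j i).2.2, (h j i).2.1⟩⟩

/-- The rule that applies `E` after `F`, for rules `E` which preserve widths and `F` which preserve
heights. -/
def Expansion.comp (E F : Expansion) : Expansion :=
  ⟨F.w, fun c => E.h (F.e c 0 0), fun c a b => E.e (F.e c a 0) 0 b⟩

theorem IsSubst.comp {E F : Expansion} {x y z : ℤ → ℤ → ℕ} {P Q P' Q' : ℤ → ℤ}
    (hE : ∀ i j, E.w (y i j) = 1) (hF : ∀ i j, F.h (z i j) = 1) (hF' : ∀ i j, 1 ≤ F.w (z i j))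
    (h : IsSubst E x y P Q) (h' : IsSubst F y z P' Q') :
    IsSubst (E.comp F) x z (P ∘ P') (Q ∘ Q') := by
  have hP : ∀ i (k : ℕ), P (i + k) = P i + k := by
    intro i k
    induction k with
    | zero => simp
    | succ k ih =>
      have := h.stepP (i + k) 0
      rw [hE, ih] at this
      push_cast at this ⊢
      rw [← add_assoc, this, add_assoc]
  have hv : ∀ i j (a : ℕ), a < F.w (z i j) → y (P' i + a) (Q' j) = F.e (z i j) a 0 := by
    intro i j a ha
    have := h'.val i j a 0 ha (by rw [hF]; exact one_pos)
    simpa using this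
  have hh : ∀ i i' j, E.h (y i j) = E.h (y i' j) := by
    intro i i' j
    have h1 := h.stepQ i j
    have h2 := h.stepQ i' j
    omega
  have h0 : ∀ i j, E.h (F.e (z i j) 0 0) = E.h (y (P' i) (Q' j)) := by
    intro i j
    have := hv i j 0 (hF' i j)
    simp only [Nat.cast_zero, add_zero] at this
    rw [this]
  refine ⟨fun i j => ?_, fun i j => ?_, fun i j a b ha hb => ?_⟩
  · simp only [Function.comp, Expansion.comp]
    rw [h'.stepP i j, hP]
  · simp only [Function.comp, Expansion.comp]
    rw [h'.stepQ i j, hF, h0]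
    simpa using h.stepQ (P' i) (Q' j)
  · simp only [Function.comp, Expansion.comp] at ha hb ⊢
    rw [h0, hh _ (P' i + a)] at hb
    have := h.val (P' i + a) (Q' j) 0 b (by rw [hE]; exact one_pos) hb
    rw [hv i j a ha] at this
    rw [← this, hP]
    simp

theorem Desubstitutes.comp {E F : Expansion} {X Y Z : Set (ℤ → ℤ → ℕ)}
    (hE : ∀ y ∈ Y, ∀ i j, E.w (y i j) = 1) (hF : ∀ z ∈ Z, ∀ i j, F.h (z i j) = 1)
    (hF' : ∀ z ∈ Z, ∀ i j, 1 ≤ F.w (z i j)) (h : Desubstitutes E X Y) (h' : Desubstitutes F Y Z) :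
    Desubstitutes (E.comp F) X Z := by
  intro x hx
  obtain ⟨y, hy, P, Q, hs, hp⟩ := h x hx
  obtain ⟨z, hz, P', Q', hs', hp'⟩ := h' y hy
  refine ⟨z, hz, _, _, hs.comp (hE y hy) (hF z hz) (hF' z hz) hs', fun p q hpq => ?_⟩
  obtain ⟨p1, q1, h1, h2, h3⟩ := hp p q hpq
  obtain ⟨p2, q2, h4, h5, h6⟩ := hp' p1 q1 h1
  exact ⟨p2, q2, h4, fun i => by simp [Function.comp, h5, h2],
    fun j => by simp [Function.comp, h6, h3]⟩

theorem IsSubst.incrP {E : Expansion} {x y : ℤ → ℤ → ℕ} {P Q : ℤ → ℤ} (h : IsSubst E x y P Q)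
    (hw : ∀ i j, 1 ≤ E.w (y i j) ∧ 1 ≤ E.h (y i j)) (i : ℤ) : P i + 1 ≤ P (i + 1) := by
  have := h.stepP i 0
  have := (hw i 0).1
  omega

theorem IsSubst.incrQ {E : Expansion} {x y : ℤ → ℤ → ℕ} {P Q : ℤ → ℤ} (h : IsSubst E x y P Q)
    (hw : ∀ i j, 1 ≤ E.w (y i j) ∧ 1 ≤ E.h (y i j)) (j : ℤ) : Q j + 1 ≤ Q (j + 1) := by
  have := h.stepQ 0 j
  have := (hw 0 j).2
  omega

theorem NoPeriods.of_desubstitutes {E : Expansion} {X Y : Set (ℤ → ℤ → ℕ)} (hY : NoPeriods Y)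
    (h : Desubstitutes E X Y) : NoPeriods X := by
  intro x hx p q hpq
  obtain ⟨y, hy, P, Q, -, hp⟩ := h x hx
  obtain ⟨p', q', h1, h2, h3⟩ := hp p q hpq
  obtain ⟨rfl, rfl⟩ := hY y hy p' q' h1
  have := h2 0
  have := h3 0
  simp_all

theorem Agree.mono {x x' : ℤ → ℤ → ℕ} {u v a₀ a₁ b₀ b₁ c₀ c₁ d₀ d₁ : ℤ}
    (h : Agree x x' u v a₀ a₁ b₀ b₁) (h1 : a₀ ≤ c₀) (h2 : c₁ ≤ a₁) (h3 : b₀ ≤ d₀) (h4 : d₁ ≤ b₁) :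
    Agree x x' u v c₀ c₁ d₀ d₁ :=
  fun i j hi hi' hj hj' => h i j (by omega) (by omega) (by omega) (by omega)

/-- Equal letters have images of equal size, so over the rectangle the grid lines of `x'` are those
of `x` displaced by a constant, which is read off at the corner `(i₀, j₀)`. -/
theorem Agree.subst {E : Expansion} {x y x' y' : ℤ → ℤ → ℕ} {P Q P' Q' : ℤ → ℤ}
    (hw : ∀ i j, 1 ≤ E.w (y i j) ∧ 1 ≤ E.h (y i j))
    (h : IsSubst E x y P Q) (h' : IsSubst E x' y' P' Q') {u v i₀ i₁ j₀ j₁ : ℤ}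
    (ha : Agree y y' u v i₀ i₁ j₀ j₁) (hi : i₀ < i₁) (hj : j₀ < j₁) :
    Agree x x' (P' (i₀ + u) - P i₀) (Q' (j₀ + v) - Q j₀) (P i₀) (P i₁) (Q j₀) (Q j₁) := by
  have hP := h.incrP hw
  have hQ := h.incrQ hw
  have hPc : ∀ i, i₀ ≤ i → i < i₁ → P' (i + u) = P i + (P' (i₀ + u) - P i₀) := by
    intro i hi0
    induction i, hi0 using Int.leInduction with
    | base => intro; ring
    | succ k hk ih =>
      intro hk1
      have h1 := h'.stepP (k + u) (j₀ + v)
      rw [ha k j₀ hk (by omega) le_rfl hj, ih (by omega)] at h1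
      rw [show k + 1 + u = k + u + 1 by ring, h1, h.stepP k j₀]
      ring
  have hQc : ∀ j, j₀ ≤ j → j < j₁ → Q' (j + v) = Q j + (Q' (j₀ + v) - Q j₀) := by
    intro j hj0
    induction j, hj0 using Int.leInduction with
    | base => intro; ring
    | succ k hk ih =>
      intro hk1
      have h1 := h'.stepQ (i₀ + u) (k + v)
      rw [ha i₀ k le_rfl hi hk (by omega), ih (by omega)] at h1
      rw [show k + 1 + v = k + v + 1 by ring, h1, h.stepQ i₀ k]
      ring
  intro m n hm hm' hn hn'
  obtain ⟨i, hi1, hi2⟩ := exists_increments_cover hP m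
  obtain ⟨j, hj1, hj2⟩ := exists_increments_cover hQ n
  have hii : i₀ ≤ i := by
    by_contra hc
    have := le_of_increments hP (show i + 1 ≤ i₀ by omega); omega
  have hii' : i < i₁ := by
    by_contra hc
    have := le_of_increments hP (show i₁ ≤ i by omega); omega
  have hjj : j₀ ≤ j := by
    by_contra hc
    have := le_of_increments hQ (show j + 1 ≤ j₀ by omega); omega
  have hjj' : j < j₁ := by
    by_contra hc
    have := le_of_increments hQ (show j₁ ≤ j by omega); omega
  obtain ⟨a, rfl⟩ : ∃ a : ℕ, m = P i + a := ⟨(m - P i).toNat, by omega⟩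
  obtain ⟨b, rfl⟩ : ∃ b : ℕ, n = Q j + b := ⟨(n - Q j).toNat, by omega⟩
  have haw : a < E.w (y i j) := by have := h.stepP i j; omega
  have hbh : b < E.h (y i j) := by have := h.stepQ i j; omega
  rw [h.val i j a b haw hbh]
  have e := ha i j hii hii' hjj hjj'
  rw [← e] at haw hbh ⊢
  rw [← h'.val _ _ a b haw hbh, hPc i hii hii', hQc j hjj hjj']
  congr 1 <;> ring

theorem UniformLanguage.of_desubstitutes {E : Expansion} {X Y : Set (ℤ → ℤ → ℕ)}
    (hY : UniformLanguage Y) (hw : E.PosOn Y) (h : Desubstitutes E X Y) : UniformLanguage X := by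
  intro x hx x' hx' N
  obtain ⟨y, hy, P, Q, hs, -⟩ := h x hx
  obtain ⟨y', hy', P', Q', hs', -⟩ := h x' hx'
  have hP := hs.incrP (hw y hy)
  have hQ := hs.incrQ (hw y hy)
  -- Increments are at least one, so the image of `[-K, K)` reaches at least from `P 0 - K` to `P 0
  -- + K`; this choice of `K` makes it contain `[-N, N)`, and likewise for rows.
  obtain ⟨K, hK⟩ : ∃ K : ℕ, N + |P 0| + |Q 0| + 1 ≤ K := ⟨(N + |P 0| + |Q 0| + 1).toNat, by omega⟩
  obtain ⟨u, v, huv⟩ := hY y hy y' hy' K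
  have a1 := le_abs_self (P 0)
  have a2 := neg_abs_le (P 0)
  have a3 := le_abs_self (Q 0)
  have a4 := neg_abs_le (Q 0)
  have hK0 : (0 : ℤ) < K := by omega
  exact ⟨_, _, (huv.subst (hw y hy) hs hs' (by omega) (by omega)).mono
    (by have := le_of_increments hP (show -(K : ℤ) ≤ 0 by omega); omega)
    (by have := le_of_increments hP (show (0 : ℤ) ≤ K by omega); omega)
    (by have := le_of_increments hQ (show -(K : ℤ) ≤ 0 by omega); omega)
    (by have := le_of_increments hQ (show (0 : ℤ) ≤ K by omega); omega)⟩

/-! ## Fusion of marker columns -/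

theorem const_of_step {α : Type*} {f : ℤ → α} (h : ∀ i, f (i + 1) = f i) (i j : ℤ) : f i = f j := by
  have key : ∀ i, f i = f 0 := by
    intro i
    induction i using Int.induction_on with
    | zero => rfl
    | succ i ih => rw [h, ih]
    | pred i ih => rw [← ih, ← h (-(i : ℤ) - 1), sub_add_cancel]
  rw [key i, key j]

/-- The rule replacing the letter `c` by the row `s[c]`. -/
def Expansion.ofRows (s : List (List ℕ)) : Expansion :=
  ⟨fun c => (s.getD c []).length, fun _ => 1, fun c a _ => (s.getD c []).getD a 0⟩

/-- The rule replacing the letter `c` by the column `s[c]`. -/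
def Expansion.ofColumns (s : List (List ℕ)) : Expansion :=
  ⟨fun _ => 1, fun c => (s.getD c []).length, fun c _ b => (s.getD c []).getD b 0⟩

/-- The letters in `M` form isolated columns of the tilings with dominoes in `H` and `V`; the words
`s[c]` are the possible rows of columns outside of `M` extended by the columns in `M` to their
right, and `H'`, `V'` contain the dominoes that they form. The letters are those below `m`. -/
structure IsFusion (m : ℕ) (H V : ℕ → ℕ → Bool) (M : ℕ → Bool) (s : List (List ℕ)) (n : ℕ)
    (H' V' : ℕ → ℕ → Bool) : Prop where
  length_eq : s.length = n
  cross : ∀ a < m, ∀ b < m, V a b = true → M a = M b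
  isolated : ∀ a < m, ∀ b < m, H a b = true → M a = true → M b = false
  words : ∀ a < m, ∀ b < m, H a b = true → M a = false → (if M b then [a, b] else [a]) ∈ s
  along : ∀ c < n, ∀ d < n,
    H ((s.getD c []).getD ((s.getD c []).length - 1) 0) ((s.getD d []).getD 0 0) = true →
      H' c d = true
  across : ∀ c < n, ∀ d < n, (s.getD c []).length = (s.getD d []).length →
    (∀ k < (s.getD c []).length, V ((s.getD c []).getD k 0) ((s.getD d []).getD k 0) = true) →
      V' c d = true

/-- By `cross`, being marked depends only on the column. The unmarked columns are enumerated by `P`,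
each is extended by the marked column to its right if there is one, and the position in `s` of the
resulting word is the new letter. A period of `x` preserves the set of marked columns, so it
permutes the fused columns by a translation of their indices. -/
theorem IsFusion.desubstitutes {m : ℕ} {H V : ℕ → ℕ → Bool} {M : ℕ → Bool} {s : List (List ℕ)}
    {n : ℕ} {H' V' : ℕ → ℕ → Bool} (h : IsFusion m H V M s n H' V') :
    Desubstitutes (Expansion.ofRows s) {x | IsTiling m H V x} {y | IsTiling n H' V' y} := by
  intro x hx
  have hH : ∀ i j, H (x i j) (x (i + 1) j) = true := fun i j => (hx i j).2.1
  have hV : ∀ i j, V (x i j) (x i (j + 1)) = true := fun i j => (hx i j).2.2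
  have hlt' : ∀ i j, x i j < m := fun i j => (hx i j).1
  have hM : ∀ i j j', M (x i j) = M (x i j') := fun i =>
    const_of_step fun j => (h.cross _ (hlt' _ _) _ (hlt' _ _) (hV i j)).symm
  obtain ⟨P, hP0, hP1, hPs⟩ := exists_enumeration (fun i => M (x i 0))
    fun i hi => h.isolated _ (hlt' _ _) _ (hlt' _ _) (hH i 0) hi
  let word : ℤ → ℤ → List ℕ := fun i j =>
    if M (x (P i + 1) 0) then [x (P i) j, x (P i + 1) j] else [x (P i) j]
  have hword : ∀ i j, word i j ∈ s := fun i j => by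
    have := h.words _ (hlt' _ _) _ (hlt' _ _) (hH (P i) j) (by rw [hM _ j 0]; exact hP0 i)
    rwa [hM _ j 0] at this
  have hs : ∀ i j, s.getD (s.idxOf (word i j)) [] = word i j := fun i j => by
    rw [List.getD_eq_getElem _ _ (List.idxOf_lt_length_of_mem (hword i j)), List.getElem_idxOf]
  have hlt : ∀ i j, s.idxOf (word i j) < n := fun i j => by
    rw [← h.length_eq]; exact List.idxOf_lt_length_of_mem (hword i j)
  have hlen : ∀ i j j', (word i j).length = (word i j').length := fun i j j' => by
    simp only [word]; split_ifs <;> rfl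
  have hget : ∀ i j k, k < (word i j).length → (word i j).getD k 0 = x (P i + k) j := by
    intro i j k hk
    simp only [word] at hk ⊢
    split_ifs at hk ⊢
    · match k, hk with
      | 0, _ => simp
      | 1, _ => simp
    · match k, hk with
      | 0, _ => simp
  have hpos : ∀ i j, 0 < (word i j).length := fun i j => by
    simp only [word]; split_ifs <;> simp
  have hstep : ∀ i j, P (i + 1) = P i + (word i j).length := fun i j => by
    rw [hP1]; simp only [word]; split_ifs <;> simp
  refine ⟨fun i j => s.idxOf (word i j), fun i j => ⟨hlt i j, ?_, ?_⟩, P, id,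
    ⟨fun i j => ?_, fun i j => ?_, fun i j a b ha hb => ?_⟩, fun p q hpq => ?_⟩
  · apply h.along _ (hlt i j) _ (hlt (i + 1) j)
    rw [hs, hs, hget _ _ _ (by have := hpos i j; omega), hget _ _ _ (hpos _ _), hstep i j]
    have := hH (P i + ((word i j).length - 1 : ℕ)) j
    rw [add_assoc] at this
    have e : (((word i j).length - 1 : ℕ) : ℤ) + 1 = (word i j).length := by
      have := hpos i j; omega
    rw [e] at this
    simpa using this
  · apply h.across _ (hlt i j) _ (hlt i (j + 1))
    · rw [hs, hs]; exact hlen _ _ _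
    · intro k hk
      rw [hs] at hk
      rw [hs, hs, hget _ _ _ hk, hget _ _ _ (by rwa [hlen _ _ j])]
      exact hV _ _
  · simp only [Expansion.ofRows, hs]; exact hstep i j
  · simp [Expansion.ofRows]
  · simp only [Expansion.ofRows, hs] at ha hb ⊢
    obtain rfl : b = 0 := by omega
    rw [hget _ _ _ ha]
    simp
  · have hm : ∀ i, M (x (i + p) 0) = M (x i 0) := fun i => by rw [hM _ 0 (0 + q), hpq]
    obtain ⟨p', hp'⟩ := hPs (P 0 + p) (by rw [hm]; exact hP0 0)
    have key : ∀ i, P (i + p') = P i + p := by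
      intro i
      induction i using Int.induction_on with
      | zero => simpa using hp'
      | succ i ih =>
        rw [show (i : ℤ) + 1 + p' = i + p' + 1 by ring, hP1, hP1, ih,
          show P i + p + 1 = P i + 1 + p by ring, hm]
        split_ifs <;> ring
      | pred i ih =>
        have h1 := hP1 (-(i : ℤ) - 1 + p')
        have h2 := hP1 (-(i : ℤ) - 1)
        rw [show -(i : ℤ) - 1 + p' + 1 = -i + p' by ring, ih] at h1
        rw [sub_add_cancel] at h2
        rw [h2] at h1
        have h3 := hm (P (-(i : ℤ) - 1))
        have h4 := hP0 (-(i : ℤ) - 1)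
        have h5 := hP0 (-(i : ℤ) - 1 + p')
        have h6 := hm (P (-(i : ℤ) - 1) + 1)
        -- If a gap and its translate had different lengths, an unmarked column would be a translate
        -- of a marked one.
        split_ifs at h1 with h7 h8 h8
        · omega
        · rw [show P (-(i : ℤ) - 1 + p') = P (-(i : ℤ) - 1) + 1 + p by omega, h6, h7] at h5
          cases h5
        · rw [show P (-(i : ℤ) - 1 + p') + 1 = P (-(i : ℤ) - 1) + p by omega, h3, h4] at h8
          cases h8
        · omega
    refine ⟨p', q, fun i j => ?_, key, fun j => rfl⟩
    have hw : word (i + p') (j + q) = word i j := by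
      simp only [word, key, show P i + p + 1 = P i + 1 + p by ring, hm, hpq _ _]
    simp only [hw]

set_option synthInstance.maxSize 1000 in
instance (m : ℕ) (H V : ℕ → ℕ → Bool) (M : ℕ → Bool) (s : List (List ℕ)) (n : ℕ)
    (H' V' : ℕ → ℕ → Bool) : Decidable (IsFusion m H V M s n H' V') :=
  decidable_of_iff (_ ∧ _ ∧ _ ∧ _ ∧ _ ∧ _)
    ⟨fun h => ⟨h.1, h.2.1, h.2.2.1, h.2.2.2.1, h.2.2.2.2.1, h.2.2.2.2.2⟩,
      fun h => ⟨h.1, h.2, h.3, h.4, h.5, h.6⟩⟩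

/-! ## Images of tilings under expansions -/

/-- `x` is a tiling on the rectangle `[i₀,i₁) × [j₀,j₁)`. -/
def IsTilingOn (n : ℕ) (H V : ℕ → ℕ → Bool) (x : ℤ → ℤ → ℕ) (i₀ i₁ j₀ j₁ : ℤ) : Prop :=
  ∀ i j, i₀ ≤ i → i < i₁ → j₀ ≤ j → j < j₁ →
    x i j < n ∧ (i + 1 < i₁ → H (x i j) (x (i + 1) j) = true) ∧
      (j + 1 < j₁ → V (x i j) (x i (j + 1)) = true)

/-- `E` maps dominoes in `H'`, `V'` to patterns all of whose dominoes are in `H`, `V`. -/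
structure Expansion.Lifts (E : Expansion) (n' : ℕ) (H' V' : ℕ → ℕ → Bool) (n : ℕ)
    (H V : ℕ → ℕ → Bool) : Prop where
  pos : ∀ c < n', 1 ≤ E.w c ∧ 1 ≤ E.h c
  letters : ∀ c < n', ∀ a < E.w c, ∀ b < E.h c, E.e c a b < n ∧
    (a + 1 < E.w c → H (E.e c a b) (E.e c (a + 1) b) = true) ∧
    (b + 1 < E.h c → V (E.e c a b) (E.e c a (b + 1)) = true)
  horizontal : ∀ c < n', ∀ d < n', H' c d = true →
    E.h c = E.h d ∧ ∀ b < E.h c, H (E.e c (E.w c - 1) b) (E.e d 0 b) = true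
  vertical : ∀ c < n', ∀ d < n', V' c d = true →
    E.w c = E.w d ∧ ∀ a < E.w c, V (E.e c a (E.h c - 1)) (E.e d a 0) = true

set_option synthInstance.maxSize 1000 in
instance (E : Expansion) (n' : ℕ) (H' V' : ℕ → ℕ → Bool) (n : ℕ) (H V : ℕ → ℕ → Bool) :
    Decidable (E.Lifts n' H' V' n H V) :=
  decidable_of_iff (_ ∧ _ ∧ _ ∧ _)
    ⟨fun h => ⟨h.1, h.2.1, h.2.2.1, h.2.2.2⟩, fun h => ⟨h.1, h.2, h.3, h.4⟩⟩

/-- Each domino of `x` lies inside the image of one letter or across the border of the images of two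
neighbours. Only a rectangle is required to be tiled, since the construction of tilings by iteration
passes through configurations that are valid only on a square. -/
theorem Expansion.Lifts.isTilingOn {E : Expansion} {n' n : ℕ} {H' V' H V : ℕ → ℕ → Bool}
    (hE : E.Lifts n' H' V' n H V) {x y : ℤ → ℤ → ℕ} {P Q : ℤ → ℤ} (h : IsSubst E x y P Q)
    (hy0 : ∀ i j, y i j < n') {i₀ i₁ j₀ j₁ : ℤ} (hy : IsTilingOn n' H' V' y i₀ i₁ j₀ j₁) :
    IsTilingOn n H V x (P i₀) (P i₁) (Q j₀) (Q j₁) := by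
  have hw : ∀ i j, 1 ≤ E.w (y i j) ∧ 1 ≤ E.h (y i j) := fun i j => hE.pos _ (hy0 i j)
  have hP := h.incrP hw
  have hQ := h.incrQ hw
  intro m n hm hm' hn hn'
  obtain ⟨i, hi1, hi2⟩ := exists_increments_cover hP m
  obtain ⟨j, hj1, hj2⟩ := exists_increments_cover hQ n
  have hii : i₀ ≤ i := by
    by_contra hc
    have := le_of_increments hP (show i + 1 ≤ i₀ by omega); omega
  have hii' : i < i₁ := by
    by_contra hc
    have := le_of_increments hP (show i₁ ≤ i by omega); omega
  have hjj : j₀ ≤ j := by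
    by_contra hc
    have := le_of_increments hQ (show j + 1 ≤ j₀ by omega); omega
  have hjj' : j < j₁ := by
    by_contra hc
    have := le_of_increments hQ (show j₁ ≤ j by omega); omega
  obtain ⟨a, rfl⟩ : ∃ a : ℕ, m = P i + a := ⟨(m - P i).toNat, by omega⟩
  obtain ⟨b, rfl⟩ : ∃ b : ℕ, n = Q j + b := ⟨(n - Q j).toNat, by omega⟩
  have sP := h.stepP i j
  have sQ := h.stepQ i j
  have haw : a < E.w (y i j) := by omega
  have hbh : b < E.h (y i j) := by omega
  have hL := hE.letters _ (hy0 i j) a haw b hbh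
  have hyij := hy i j hii hii' hjj hjj'
  rw [h.val i j a b haw hbh]
  refine ⟨hL.1, fun hlt => ?_, fun hlt => ?_⟩
  · by_cases ha : a + 1 < E.w (y i j)
    · have := h.val i j (a + 1) b ha hbh
      rw [show P i + (a : ℤ) + 1 = P i + ((a + 1 : ℕ) : ℤ) by push_cast; ring, this]
      exact hL.2.1 ha
    · have hi3 : i + 1 < i₁ := by
        by_contra hc
        have := le_of_increments hP (show i₁ ≤ i + 1 by omega); omega
      obtain ⟨e1, e2⟩ := hE.horizontal _ (hy0 i j) _ (hy0 (i + 1) j) (hyij.2.1 hi3)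
      have := h.val (i + 1) j 0 b (hw _ _).1 (e1 ▸ hbh)
      rw [show P i + (a : ℤ) + 1 = P (i + 1) + ((0 : ℕ) : ℤ) by push_cast; omega, this]
      have := e2 b hbh
      rwa [show E.w (y i j) - 1 = a by omega] at this
  · by_cases hb : b + 1 < E.h (y i j)
    · have := h.val i j a (b + 1) haw hb
      rw [show Q j + (b : ℤ) + 1 = Q j + ((b + 1 : ℕ) : ℤ) by push_cast; ring, this]
      exact hL.2.2 hb
    · have hj3 : j + 1 < j₁ := by
        by_contra hc
        have := le_of_increments hQ (show j₁ ≤ j + 1 by omega); omega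
      obtain ⟨e1, e2⟩ := hE.vertical _ (hy0 i j) _ (hy0 i (j + 1)) (hyij.2.2 hj3)
      have := h.val i (j + 1) a 0 (e1 ▸ haw) (hw _ _).2
      rw [show Q j + (b : ℤ) + 1 = Q (j + 1) + ((0 : ℕ) : ℤ) by push_cast; omega, this]
      have := e2 a haw
      rwa [show E.h (y i j) - 1 = b by omega] at this

/-- The images fit into a grid as soon as widths are constant along columns and heights along rows;
no matching of letters is needed. -/
theorem exists_isSubst {E : Expansion} {y : ℤ → ℤ → ℕ}
    (hpos : ∀ i j, 1 ≤ E.w (y i j) ∧ 1 ≤ E.h (y i j))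
    (hw : ∀ i j j', E.w (y i j) = E.w (y i j')) (hh : ∀ i i' j, E.h (y i j) = E.h (y i' j)) :
    ∃ x P Q, P 0 = 0 ∧ Q 0 = 0 ∧ IsSubst E x y P Q := by
  obtain ⟨P, hP0, hP⟩ := exists_seq_of_increments fun i => E.w (y i 0)
  obtain ⟨Q, hQ0, hQ⟩ := exists_seq_of_increments fun j => E.h (y 0 j)
  have hP' : ∀ i, P i + 1 ≤ P (i + 1) := fun i => by
    have := hP i; have := (hpos i 0).1; omega
  have hQ' : ∀ i, Q i + 1 ≤ Q (i + 1) := fun i => by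
    have := hQ i; have := (hpos 0 i).2; omega
  choose f hf1 hf2 using exists_increments_cover hP'
  choose g hg1 hg2 using exists_increments_cover hQ'
  refine ⟨fun m n => E.e (y (f m) (g n)) (m - P (f m)).toNat (n - Q (g n)).toNat, P, Q, hP0, hQ0,
    fun i j => by rw [hP, hw i 0 j], fun i j => by rw [hQ, hh 0 i j], fun i j a b ha hb => ?_⟩
  have e1 : f (P i + a) = i := increments_cover_unique hP' (hf1 _) (hf2 _) (by omega)
    (by have := hP i; rw [hw i 0 j] at this; omega)
  have e2 : g (Q j + b) = j := increments_cover_unique hQ' (hg1 _) (hg2 _) (by omega)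
    (by have := hQ j; rw [hh 0 i j] at this; omega)
  simp only [e1, e2]
  congr 1 <;> omega

theorem isTiling_iff_forall_isTilingOn {n : ℕ} {H V : ℕ → ℕ → Bool} {x : ℤ → ℤ → ℕ} :
    IsTiling n H V x ↔ ∀ N : ℕ, IsTilingOn n H V x (-N) N (-N) N := by
  refine ⟨fun h N i j _ _ _ _ => ⟨(h i j).1, fun _ => (h i j).2.1, fun _ => (h i j).2.2⟩,
    fun h i j => ?_⟩
  have := h (|i| + |j| + 2).toNat i j
  have h1 := neg_abs_le i
  have h2 := neg_abs_le j
  have h3 := le_abs_self i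
  have h4 := le_abs_self j
  have h5 := this (by omega) (by omega) (by omega) (by omega)
  exact ⟨h5.1, h5.2.1 (by omega), h5.2.2 (by omega)⟩

theorem Expansion.Lifts.nonempty {E : Expansion} {n' n : ℕ} {H' V' H V : ℕ → ℕ → Bool}
    (hE : E.Lifts n' H' V' n H V) (h : {y | IsTiling n' H' V' y}.Nonempty) :
    {x | IsTiling n H V x}.Nonempty := by
  obtain ⟨y, hy⟩ := h
  have hw : ∀ i j, 1 ≤ E.w (y i j) ∧ 1 ≤ E.h (y i j) := fun i j => hE.pos _ (hy i j).1
  obtain ⟨x, P, Q, hP0, hQ0, hs⟩ := exists_isSubst hw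
    (fun i => const_of_step fun j =>
      ((hE.vertical _ (hy i j).1 _ (hy i (j + 1)).1 (hy i j).2.2).1).symm)
    (fun i i' j => const_of_step (f := fun i => E.h (y i j)) (fun i =>
      ((hE.horizontal _ (hy i j).1 _ (hy (i + 1) j).1 (hy i j).2.1).1).symm) i i')
  refine ⟨x, isTiling_iff_forall_isTilingOn.2 fun N => ?_⟩
  have := hE.isTilingOn hs (fun i j => (hy i j).1) (isTiling_iff_forall_isTilingOn.1 hy N)
  have hP := hs.incrP hw
  have hQ := hs.incrQ hw
  have h1 := le_of_increments hP (show -(N : ℤ) ≤ 0 by omega)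
  have h2 := le_of_increments hP (show (0 : ℤ) ≤ N by omega)
  have h3 := le_of_increments hQ (show -(N : ℤ) ≤ 0 by omega)
  have h4 := le_of_increments hQ (show (0 : ℤ) ≤ N by omega)
  intro i j hi hi' hj hj'
  obtain ⟨g1, g2, g3⟩ := this i j (by omega) (by omega) (by omega) (by omega)
  exact ⟨g1, fun _ => g2 (by omega), fun _ => g3 (by omega)⟩

/-- Compactness: along a nonprincipal ultrafilter each cell takes one of its finitely many letters
eventually, and the letters so chosen satisfy the local rules because any two cells are eventually
correct together. -/
theorem exists_isTiling_of_isTilingOn {n : ℕ} {H V : ℕ → ℕ → Bool}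
    (h : ∀ N : ℕ, ∃ x, IsTilingOn n H V x (-N) N (-N) N) : {x | IsTiling n H V x}.Nonempty := by
  choose x hx using h
  let F : Ultrafilter ℕ := Filter.hyperfilter ℕ
  have hF : ∀ k : ℕ, ∀ᶠ N in (F : Filter ℕ), k ≤ N := fun k => by
    have : (F : Filter ℕ) ≤ Filter.atTop := by
      rw [← Nat.cofinite_eq_atTop]; exact Filter.hyperfilter_le_cofinite
    exact this (Filter.eventually_ge_atTop k)
  have hlim : ∀ i j, ∃ a < n, ∀ᶠ N in (F : Filter ℕ), x N i j = a := by
    intro i j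
    have h1 : ∀ᶠ N in (F : Filter ℕ), ∃ a ∈ Set.Iio n, x N i j = a := by
      filter_upwards [hF (|i| + |j| + 1).toNat] with N hN
      have h1 := neg_abs_le i
      have h2 := neg_abs_le j
      have h3 := le_abs_self i
      have h4 := le_abs_self j
      exact ⟨_, (hx N i j (by omega) (by omega) (by omega) (by omega)).1, rfl⟩
    exact (Ultrafilter.eventually_exists_mem_iff (Set.finite_Iio n)).1 h1
  choose f hfn hf using hlim
  refine ⟨f, fun i j => ⟨hfn i j, ?_⟩⟩
  obtain ⟨N, hN, h0, h1, h2⟩ := ((hF (|i| + |j| + 2).toNat).and ((hf i j).and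
    ((hf (i + 1) j).and (hf i (j + 1))))).exists
  have g1 := neg_abs_le i
  have g2 := neg_abs_le j
  have g3 := le_abs_self i
  have g4 := le_abs_self j
  obtain ⟨-, k2, k3⟩ := hx N i j (by omega) (by omega) (by omega) (by omega)
  rw [← h0, ← h1, ← h2]
  exact ⟨k2 (by omega), k3 (by omega)⟩

/-! ## Self-similar classes of configurations -/

/-- For `p' > 0` the increments give `p' ≤ p`, and equality would force every increment to be one,
contrary to `hP2`. Negative `p'` reduces to this by reversing the translation. -/
theorem natAbs_lt_of_increments {P : ℤ → ℤ} (hP : ∀ i, P i + 1 ≤ P (i + 1))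
    (hP2 : ∀ i, P i + 3 ≤ P (i + 2)) {p p' : ℤ} (h : ∀ i, P (i + p') = P i + p) :
    p' = 0 ∧ p = 0 ∨ p'.natAbs < p.natAbs := by
  have key : ∀ p p' : ℤ, 0 < p' → (∀ i, P (i + p') = P i + p) → p' < p := by
    intro p p' hp' h
    have h1 := le_of_increments hP (show (0 : ℤ) ≤ 0 + p' by omega)
    rw [h] at h1
    rcases (show p' ≤ p by omega).lt_or_eq with h2 | rfl
    · exact h2
    · have h3 : ∀ i, P (i + 1) = P i + 1 := by
        intro i
        have h4 := le_of_increments hP (show i + 1 ≤ i + p' by omega)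
        have := hP i
        rw [h] at h4
        omega
      have := hP2 0
      have e := h3 (0 + 1)
      rw [add_assoc, h3] at e
      norm_num at e this
      omega
  rcases lt_trichotomy p' 0 with h0 | h0 | h0
  · right
    have := key (-p) (-p') (by omega) fun i => by
      have := h (i + -p')
      rw [neg_add_cancel_right] at this
      omega
    omega
  · left
    subst h0
    have := h 0
    rw [add_zero] at this
    omega
  · right
    have := key p p' h0 h
    omega

/-- In the configurations of `X` no two consecutive columns or rows are replaced by single ones. -/
def Expansion.NoThin (E : Expansion) (X : Set (ℤ → ℤ → ℕ)) : Prop :=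
  ∀ x ∈ X, ∀ i j, 3 ≤ E.w (x i j) + E.w (x (i + 1) j) ∧ 3 ≤ E.h (x i j) + E.h (x i (j + 1))

theorem NoPeriods.of_selfSimilar {E : Expansion} {X : Set (ℤ → ℤ → ℕ)}
    (h : Desubstitutes E X X) (hpos : E.PosOn X) (hthin : E.NoThin X) : NoPeriods X := by
  have key : ∀ N : ℕ, ∀ x ∈ X, ∀ p q : ℤ, p.natAbs + q.natAbs ≤ N → HasPeriod x p q →
      p = 0 ∧ q = 0 := by
    intro N
    induction N with
    | zero => intro x _ p q hpq _; omega
    | succ N ih =>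
      intro x hx p q hpq hper
      obtain ⟨y, hy, P, Q, hs, hp⟩ := h x hx
      obtain ⟨p', q', h1, h2, h3⟩ := hp p q hper
      have hP := natAbs_lt_of_increments (hs.incrP (hpos y hy)) (fun i => by
        have e1 := hs.stepP i 0
        have e2 := hs.stepP (i + 1) 0
        have := (hthin y hy i 0).1
        rw [show i + 2 = i + 1 + 1 by ring]
        omega) h2
      have hQ := natAbs_lt_of_increments (hs.incrQ (hpos y hy)) (fun j => by
        have e1 := hs.stepQ 0 j
        have e2 := hs.stepQ 0 (j + 1)
        have := (hthin y hy 0 j).2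
        rw [show j + 2 = j + 1 + 1 by ring]
        omega) h3
      -- If the sum has not dropped, then neither coordinate has strictly decreased, and so `p` and
      -- `q` are both zero.
      by_cases hlt : p'.natAbs + q'.natAbs ≤ N
      · obtain ⟨rfl, rfl⟩ := ih y hy p' q' hlt h1
        have e1 := h2 0
        have e2 := h3 0
        rw [add_zero] at e1 e2
        omega
      · omega
  exact fun x hx p q hper => key _ x hx p q le_rfl hper

/-- A window of length `m + 1` is covered by the twofold image of only `m` consecutive letters,
which drives the induction on the size of patterns. Counting increments as at least one covers all
but one place. The missing place is gained either from an increment of `P'` larger than one or, if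
the increment of `P'` at `k + 1` is one, from the increment of `P` that then exceeds one by `h`. -/
theorem exists_cover_two_levels {P P' : ℤ → ℤ} (hP : ∀ i, P i + 1 ≤ P (i + 1))
    (hP' : ∀ i, P' i + 1 ≤ P' (i + 1))
    (h : ∀ i, P' (i + 1) = P' i + 1 → P (P' i) + 2 ≤ P (P' i + 1)) {m : ℤ} (hm : 2 ≤ m) (a : ℤ) :
    ∃ k, P (P' k) ≤ a ∧ a + m + 1 ≤ P (P' (k + m)) := by
  obtain ⟨i, hi, hi'⟩ := exists_increments_cover hP a
  obtain ⟨k, hk, hk'⟩ := exists_increments_cover hP' i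
  have mono : ∀ {i j}, i ≤ j → P i + (j - i) ≤ P j := fun h => le_of_increments hP h
  have mono' : ∀ {i j}, i ≤ j → P' i + (j - i) ≤ P' j := fun h => le_of_increments hP' h
  have h0 := mono hk
  refine ⟨k, by omega, ?_⟩
  have e1 := mono' (show k + 1 ≤ k + m by omega)
  have e2 := mono (show i + m ≤ P' (k + m) by omega)
  have e3 := mono (show i + 1 ≤ i + m by omega)
  by_contra hc
  have e4 : P' (k + m) = i + m := by
    by_contra hne
    have := mono (show i + m + 1 ≤ P' (k + m) by omega)
    have := mono (show i + 1 ≤ i + m + 1 by omega)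
    omega
  have e5 : P' (k + 1) = i + 1 := by omega
  have e6 : P' (k + 2) = i + 2 := by
    have := mono' (show k + 2 ≤ k + m by omega)
    have := mono' (show k + 1 ≤ k + 2 by omega)
    omega
  have := h (k + 1) (by rw [show k + 1 + 1 = k + 2 by ring]; omega)
  rw [e5] at this
  have := mono (show i + 1 + 1 ≤ i + m by omega)
  omega

/-- The `2 × 2` pattern of `x` with lower left corner `(i, j)`, as the tuple of its lower left,
lower right, upper left and upper right letters. -/
def blockAt (x : ℤ → ℤ → ℕ) (i j : ℤ) : ℕ × ℕ × ℕ × ℕ :=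
  (x i j, x (i + 1) j, x i (j + 1), x (i + 1) (j + 1))

/-- The letter in column `a` and row `b` of the image of a `2 × 2` pattern. -/
def Expansion.patch (E : Expansion) (c : ℕ × ℕ × ℕ × ℕ) (a b : ℕ) : ℕ :=
  if a < E.w c.1 then
    if b < E.h c.1 then E.e c.1 a b else E.e c.2.2.1 a (b - E.h c.1)
  else
    if b < E.h c.1 then E.e c.2.1 (a - E.w c.1) b
    else E.e c.2.2.2 (a - E.w c.1) (b - E.h c.1)

/-- The `2 × 2` patterns in the image of a `2 × 2` pattern. -/
def Expansion.subBlocks (E : Expansion) (c : ℕ × ℕ × ℕ × ℕ) : List (ℕ × ℕ × ℕ × ℕ) :=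
  (List.range (E.w c.1 + E.w c.2.1 - 1)).flatMap fun a =>
    (List.range (E.h c.1 + E.h c.2.2.1 - 1)).map fun b =>
      (E.patch c a b, E.patch c (a + 1) b, E.patch c a (b + 1), E.patch c (a + 1) (b + 1))

theorem IsSubst.patch_eq {E : Expansion} {x y : ℤ → ℤ → ℕ} {P Q : ℤ → ℤ} (h : IsSubst E x y P Q)
    (i j : ℤ) {a b : ℕ} (ha : a < E.w (y i j) + E.w (y (i + 1) j))
    (hb : b < E.h (y i j) + E.h (y i (j + 1))) :
    x (P i + a) (Q j + b) = E.patch (blockAt y i j) a b := by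
  have p1 := h.stepP i j
  have p2 := h.stepP i (j + 1)
  have p3 := h.stepP (i + 1) j
  have p4 := h.stepP (i + 1) (j + 1)
  have q1 := h.stepQ i j
  have q2 := h.stepQ i (j + 1)
  have q3 := h.stepQ (i + 1) j
  have q4 := h.stepQ (i + 1) (j + 1)
  simp only [Expansion.patch, blockAt]
  by_cases h1 : a < E.w (y i j) <;> by_cases h2 : b < E.h (y i j) <;>
    simp only [h1, h2, if_true, if_false]
  · exact h.val i j a b h1 h2
  · rw [← h.val i (j + 1) a _ (by omega) (by omega)]
    congr 1; omega
  · rw [← h.val (i + 1) j _ b (by omega) (by omega)]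
    congr 1; omega
  · rw [← h.val (i + 1) (j + 1) _ _ (by omega) (by omega)]
    congr 1 <;> omega

theorem IsSubst.blockAt_eq {E : Expansion} {x y : ℤ → ℤ → ℕ} {P Q : ℤ → ℤ} (h : IsSubst E x y P Q)
    (i j : ℤ) {a b : ℕ} (ha : a + 1 < E.w (y i j) + E.w (y (i + 1) j))
    (hb : b + 1 < E.h (y i j) + E.h (y i (j + 1))) :
    blockAt x (P i + a) (Q j + b) = (E.patch (blockAt y i j) a b,
      E.patch (blockAt y i j) (a + 1) b, E.patch (blockAt y i j) a (b + 1),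
      E.patch (blockAt y i j) (a + 1) (b + 1)) := by
  rw [← h.patch_eq i j (by omega) (by omega), ← h.patch_eq i j ha (by omega),
    ← h.patch_eq i j (by omega) hb, ← h.patch_eq i j ha hb]
  simp [blockAt, add_assoc]

/-- Together with `IsSubst.exists_blockAt_mem` this makes `E` act on sets of `2 × 2` patterns: a `2
× 2` window meets at most two columns and two rows of images. -/
theorem IsSubst.exists_blockAt_of_mem {E : Expansion} {x y : ℤ → ℤ → ℕ} {P Q : ℤ → ℤ}
    (h : IsSubst E x y P Q) (i j : ℤ) {d : ℕ × ℕ × ℕ × ℕ} (hd : d ∈ E.subBlocks (blockAt y i j)) :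
    ∃ k l, blockAt x k l = d := by
  simp only [Expansion.subBlocks, List.mem_flatMap, List.mem_map, List.mem_range] at hd
  obtain ⟨a, ha, b, hb, rfl⟩ := hd
  simp only [blockAt] at ha hb
  exact ⟨_, _, h.blockAt_eq i j (by omega) (by omega)⟩

theorem IsSubst.exists_blockAt_mem {E : Expansion} {x y : ℤ → ℤ → ℕ} {P Q : ℤ → ℤ}
    (h : IsSubst E x y P Q) (hpos : ∀ i j, 1 ≤ E.w (y i j) ∧ 1 ≤ E.h (y i j)) (k l : ℤ) :
    ∃ i j, blockAt x k l ∈ E.subBlocks (blockAt y i j) := by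
  obtain ⟨i, hi, hi'⟩ := exists_increments_cover (h.incrP hpos) k
  obtain ⟨j, hj, hj'⟩ := exists_increments_cover (h.incrQ hpos) l
  obtain ⟨a, rfl⟩ : ∃ a : ℕ, k = P i + a := ⟨(k - P i).toNat, by omega⟩
  obtain ⟨b, rfl⟩ : ∃ b : ℕ, l = Q j + b := ⟨(l - Q j).toNat, by omega⟩
  have := h.stepP i j
  have := h.stepQ i j
  have := (hpos (i + 1) j).1
  have := (hpos i (j + 1)).2
  refine ⟨i, j, ?_⟩
  simp only [Expansion.subBlocks, List.mem_flatMap, List.mem_map, List.mem_range]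
  refine ⟨a, ?_, b, ?_, (h.blockAt_eq i j (by omega) (by omega)).symm⟩ <;>
  · simp only [blockAt]; omega

/-- All `2 × 2` patterns in the images of those in `l`. -/
def Expansion.subBlocksOf (E : Expansion) (l : List (ℕ × ℕ × ℕ × ℕ)) : List (ℕ × ℕ × ℕ × ℕ) :=
  (l.flatMap E.subBlocks).foldr List.insert []

theorem Expansion.mem_subBlocksOf {E : Expansion} {l : List (ℕ × ℕ × ℕ × ℕ)}
    {d : ℕ × ℕ × ℕ × ℕ} : d ∈ E.subBlocksOf l ↔ ∃ c ∈ l, d ∈ E.subBlocks c := by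
  have : ∀ l : List (ℕ × ℕ × ℕ × ℕ), d ∈ l.foldr List.insert [] ↔ d ∈ l := by
    intro l
    induction l with
    | nil => simp
    | cons c l ih => simp [List.foldr_cons, ih]
  rw [subBlocksOf, this, List.mem_flatMap]

/-- A pattern from `S` is found in the `k`-fold preimage of `x` and its iterated image is carried
down to `x`; which pattern of `S` it is may depend on `x`. -/
theorem Desubstitutes.exists_blocks {E : Expansion} {X : Set (ℤ → ℤ → ℕ)}
    (h : Desubstitutes E X X) {S : List (ℕ × ℕ × ℕ × ℕ)}
    (hS : ∀ x ∈ X, ∃ c ∈ S, ∃ i j, blockAt x i j = c) (k : ℕ) :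
    ∀ x ∈ X, ∃ c ∈ S, ∀ d ∈ E.subBlocksOf^[k] [c], ∃ i j, blockAt x i j = d := by
  induction k with
  | zero =>
    intro x hx
    obtain ⟨c, hc, hij⟩ := hS x hx
    refine ⟨c, hc, fun d hd => ?_⟩
    rwa [List.mem_singleton.1 hd]
  | succ k ih =>
    intro x hx
    obtain ⟨y, hy, P, Q, hs, -⟩ := h x hx
    obtain ⟨c, hc, hd⟩ := ih y hy
    refine ⟨c, hc, fun d hd' => ?_⟩
    rw [Function.iterate_succ_apply', Expansion.mem_subBlocksOf] at hd'
    obtain ⟨c', hc', hd'⟩ := hd'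
    obtain ⟨i, j, rfl⟩ := hd c' hc'
    exact hs.exists_blockAt_of_mem i j hd'

/-- Letters whose image has a single column (row) have only letters in their images whose images
have several columns (rows). -/
def Expansion.ThinToThick (E : Expansion) (n : ℕ) : Prop :=
  ∀ c < n, (E.w c = 1 → ∀ b < E.h c, 2 ≤ E.w (E.e c 0 b)) ∧
    (E.h c = 1 → ∀ a < E.w c, 2 ≤ E.h (E.e c a 0))

instance (E : Expansion) (n : ℕ) : Decidable (E.ThinToThick n) := by
  unfold Expansion.ThinToThick; infer_instance

/-- Induction on the side of the square, starting with `2 × 2`. A square of side `m + 3` lies in the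
twofold image of one of side `m + 2` by `exists_cover_two_levels`, whose hypothesis is supplied by
`ThinToThick`. One level would not do, as a single column or row may remain single. -/
theorem UniformLanguage.of_selfSimilar {E : Expansion} {X : Set (ℤ → ℤ → ℕ)} {n : ℕ}
    (h : Desubstitutes E X X) (hpos : E.PosOn X) (hn : ∀ x ∈ X, ∀ i j, x i j < n)
    (hthick : E.ThinToThick n)
    (hb : ∀ x ∈ X, ∀ x' ∈ X, ∀ i j, ∃ i' j', blockAt x' i' j' = blockAt x i j) :
    UniformLanguage X := by
  have key : ∀ m : ℕ, ∀ x ∈ X, ∀ x' ∈ X, ∀ a b : ℤ,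
      ∃ u v, Agree x x' u v a (a + (m + 2 : ℕ)) b (b + (m + 2 : ℕ)) := by
    intro m
    induction m with
    | zero =>
      intro x hx x' hx' a b
      obtain ⟨i, j, hij⟩ := hb x hx x' hx' a b
      simp only [blockAt, Prod.mk.injEq] at hij
      refine ⟨i - a, j - b, fun k l hk hk' hl hl' => ?_⟩
      push_cast at hk' hl'
      obtain rfl | rfl : k = a ∨ k = a + 1 := by omega
      · obtain rfl | rfl : l = b ∨ l = b + 1 := by omega
        · simpa using hij.1
        · simpa [add_right_comm] using hij.2.2.1
      · obtain rfl | rfl : l = b ∨ l = b + 1 := by omega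
        · simpa [add_right_comm] using hij.2.1
        · simpa [add_right_comm] using hij.2.2.2
    | succ m ih =>
      intro x hx x' hx' a b
      obtain ⟨y, hy, P, Q, hs, -⟩ := h x hx
      obtain ⟨z, hz, P2, Q2, hs2, -⟩ := h y hy
      obtain ⟨y', hy', P', Q', hs', -⟩ := h x' hx'
      obtain ⟨z', hz', P2', Q2', hs2', -⟩ := h y' hy'
      have hm : (2 : ℤ) ≤ (m + 2 : ℕ) := by push_cast; omega
      obtain ⟨k, hk, hk'⟩ := exists_cover_two_levels (hs.incrP (hpos y hy))
        (hs2.incrP (hpos z hz)) (fun i hi => by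
          have e1 := hs2.stepP i 0
          have e2 := hs2.val i 0 0 0 (hpos z hz i 0).1 (hpos z hz i 0).2
          have e3 := (hthick _ (hn z hz i 0)).1 (by omega) 0 (hpos z hz i 0).2
          simp only [Nat.cast_zero, add_zero] at e2
          have e4 := hs.stepP (P2 i) (Q2 0)
          rw [← e2] at e3
          omega) hm a
      obtain ⟨l, hl, hl'⟩ := exists_cover_two_levels (hs.incrQ (hpos y hy))
        (hs2.incrQ (hpos z hz)) (fun j hj => by
          have e1 := hs2.stepQ 0 j
          have e2 := hs2.val 0 j 0 0 (hpos z hz 0 j).1 (hpos z hz 0 j).2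
          have e3 := (hthick _ (hn z hz 0 j)).2 (by omega) 0 (hpos z hz 0 j).1
          simp only [Nat.cast_zero, add_zero] at e2
          have e4 := hs.stepQ (P2 0) (Q2 j)
          rw [← e2] at e3
          omega) hm b
      obtain ⟨u, v, huv⟩ := ih z hz z' hz' k l
      have g1 := huv.subst (hpos z hz) hs2 hs2' (by omega) (by omega)
      have g2 := g1.subst (hpos y hy) hs hs'
        (by have := le_of_increments (hs2.incrP (hpos z hz))
              (show k ≤ k + (m + 2 : ℕ) by omega); omega)
        (by have := le_of_increments (hs2.incrQ (hpos z hz))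
              (show l ≤ l + (m + 2 : ℕ) by omega); omega)
      exact ⟨_, _, g2.mono hk (by push_cast at hk' ⊢; omega) hl (by push_cast at hl' ⊢; omega)⟩
  intro x hx x' hx' N
  obtain ⟨u, v, huv⟩ := key (2 * N) x hx x' hx' (-N) (-N)
  exact ⟨u, v, huv.mono le_rfl (by push_cast; omega) le_rfl (by push_cast; omega)⟩

/-- Numbers of columns (rows) of images of letters in the same column (row) of an image depend
only on the column (row) and the number of columns (rows) of the image. -/
def Expansion.Coherent (E : Expansion) (n : ℕ) : Prop :=
  ∀ c < n, ∀ d < n,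
    (E.w c = E.w d → ∀ a < E.w c, ∀ b < E.h c, ∀ b' < E.h d,
      E.w (E.e c a b) = E.w (E.e d a b')) ∧
    (E.h c = E.h d → ∀ b < E.h c, ∀ a < E.w c, ∀ a' < E.w d,
      E.h (E.e c a b) = E.h (E.e d a' b))

set_option synthInstance.maxSize 1000 in
instance (E : Expansion) (n : ℕ) : Decidable (E.Coherent n) := by
  unfold Expansion.Coherent; infer_instance

/-- The constant configuration `c` is valid on a `1 × 1` square. Iterating `E` enlarges the valid
square at the origin, while outside it only the coherence of widths and heights is maintained, which
suffices to apply `E` to the whole plane again. -/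
theorem nonempty_of_selfSimilar {E : Expansion} {n : ℕ} {H V : ℕ → ℕ → Bool}
    (hE : E.Lifts n H V n H V) (hcoh : E.Coherent n)
    (hcorner : ∀ c < n, 2 ≤ E.w c → 2 ≤ E.h c → 2 ≤ E.w (E.e c 0 0) ∧ 2 ≤ E.h (E.e c 0 0))
    {c : ℕ} (hc : c < n) (hcw : 2 ≤ E.w c) (hch : 2 ≤ E.h c) :
    {x | IsTiling n H V x}.Nonempty := by
  have key : ∀ k : ℕ, ∃ x : ℤ → ℤ → ℕ, (∀ i j, x i j < n) ∧
      (∀ i j j', E.w (x i j) = E.w (x i j')) ∧ (∀ i i' j, E.h (x i j) = E.h (x i' j)) ∧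
      2 ≤ E.w (x 0 0) ∧ 2 ≤ E.h (x 0 0) ∧ IsTilingOn n H V x 0 (k + 1) 0 (k + 1) := by
    intro k
    induction k with
    | zero =>
      exact ⟨fun _ _ => c, fun _ _ => hc, fun _ _ _ => rfl, fun _ _ _ => rfl, hcw, hch,
        fun i j _ _ _ _ => ⟨hc, fun _ => by omega, fun _ => by omega⟩⟩
    | succ k ih =>
      obtain ⟨y, hy, hw, hh, hw0, hh0, hyk⟩ := ih
      have hpos : ∀ i j, 1 ≤ E.w (y i j) ∧ 1 ≤ E.h (y i j) := fun i j => hE.pos _ (hy i j)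
      obtain ⟨x, P, Q, hP0, hQ0, hs⟩ := exists_isSubst hpos hw hh
      have hP := hs.incrP hpos
      have hQ := hs.incrQ hpos
      have hval : ∀ k l, ∃ i j, ∃ a < E.w (y i j), ∃ b < E.h (y i j), P i ≤ k ∧ k < P (i + 1) ∧
          Q j ≤ l ∧ l < Q (j + 1) ∧ k = P i + a ∧ l = Q j + b ∧ x k l = E.e (y i j) a b := by
        intro k l
        obtain ⟨i, hi, hi'⟩ := exists_increments_cover hP k
        obtain ⟨j, hj, hj'⟩ := exists_increments_cover hQ l
        obtain ⟨a, rfl⟩ : ∃ a : ℕ, k = P i + a := ⟨(k - P i).toNat, by omega⟩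
        obtain ⟨b, rfl⟩ : ∃ b : ℕ, l = Q j + b := ⟨(l - Q j).toNat, by omega⟩
        have p1 := hs.stepP i j
        have q1 := hs.stepQ i j
        exact ⟨i, j, a, by omega, b, by omega, hi, hi', hj, hj', rfl, rfl,
          hs.val i j a b (by omega) (by omega)⟩
      have h00 := hs.val 0 0 0 0 (hpos 0 0).1 (hpos 0 0).2
      simp only [Nat.cast_zero, add_zero, hP0, hQ0] at h00
      refine ⟨x, fun k l => ?_, fun k l l' => ?_, fun k k' l => ?_, ?_, ?_, ?_⟩
      · obtain ⟨i, j, a, ha, b, hb, -, -, -, -, -, -, e⟩ := hval k l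
        rw [e]
        exact (hE.letters _ (hy i j) a ha b hb).1
      · obtain ⟨i, j, a, ha, b, hb, h1, h2, -, -, h3, -, e⟩ := hval k l
        obtain ⟨i', j', a', ha', b', hb', h1', h2', -, -, h3', -, e'⟩ := hval k l'
        obtain rfl := increments_cover_unique hP h1 h2 h1' h2'
        obtain rfl : a = a' := by omega
        rw [e, e']
        exact (hcoh _ (hy i j) _ (hy i j')).1 (hw i j j') a ha b hb b' hb'
      · obtain ⟨i, j, a, ha, b, hb, -, -, h1, h2, -, h3, e⟩ := hval k l
        obtain ⟨i', j', a', ha', b', hb', -, -, h1', h2', -, h3', e'⟩ := hval k' l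
        obtain rfl := increments_cover_unique hQ h1 h2 h1' h2'
        obtain rfl : b = b' := by omega
        rw [e, e']
        exact (hcoh _ (hy i j) _ (hy i' j)).2 (hh i i' j) b hb a ha a' ha'
      · rw [h00]; exact (hcorner _ (hy 0 0) hw0 hh0).1
      · rw [h00]; exact (hcorner _ (hy 0 0) hw0 hh0).2
      · have := hE.isTilingOn hs hy hyk
        have p1 := hs.stepP 0 0
        have q1 := hs.stepQ 0 0
        -- The letter at the origin has an image of width at least two, so `P (k + 1) ≥ P 1 + k ≥ k
        -- + 2`: the valid square grows. `hcorner` keeps the letter at the origin of this kind.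
        have p2 := le_of_increments hP (show (0 : ℤ) + 1 ≤ k + 1 by omega)
        have q2 := le_of_increments hQ (show (0 : ℤ) + 1 ≤ k + 1 by omega)
        intro i j hi hi' hj hj'
        push_cast at hi' hj'
        obtain ⟨g1, g2, g3⟩ := this i j (by omega) (by omega) (by omega) (by omega)
        push_cast
        exact ⟨g1, fun _ => g2 (by omega), fun _ => g3 (by omega)⟩
  apply exists_isTiling_of_isTilingOn
  intro N
  obtain ⟨x, -, -, -, -, -, hx⟩ := key (2 * N)
  refine ⟨fun i j => x (i + N) (j + N), fun i j hi hi' hj hj' => ?_⟩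
  obtain ⟨g1, g2, g3⟩ := hx (i + N) (j + N) (by omega) (by push_cast; omega) (by omega)
    (by push_cast; omega)
  push_cast at g2 g3
  refine ⟨g1, fun _ => ?_, fun _ => ?_⟩
  · simp only [add_right_comm i 1]; exact g2 (by omega)
  · simp only [add_right_comm j 1]; exact g3 (by omega)

/-! ## Shears -/

/-- The shear matching horizontal neighbours with horizontal neighbours and diagonal neighbours
with vertical neighbours. -/
theorem uniformLanguage_of_shear {X Y : Set (ℤ → ℤ → ℕ)}
    (h : ∀ x ∈ X, (fun i j => x (i + j) j) ∈ Y) (hY : UniformLanguage Y) : UniformLanguage X := by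
  intro x hx x' hx' N
  -- The sheared coordinate `i - j` ranges within `[-2N, 2N)`.
  obtain ⟨u, v, huv⟩ := hY _ (h x hx) _ (h x' hx') (2 * N)
  refine ⟨u + v, v, fun i j hi hi' hj hj' => ?_⟩
  have := huv (i - j) j (by push_cast; omega) (by push_cast; omega) (by push_cast; omega)
    (by push_cast; omega)
  simpa [show i - j + u + (j + v) = i + (u + v) by ring] using this

theorem noPeriods_of_shear {X Y : Set (ℤ → ℤ → ℕ)}
    (h : ∀ x ∈ X, (fun i j => x (i + j) j) ∈ Y) (hY : NoPeriods Y) : NoPeriods X := by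
  intro x hx p q hpq
  have := hY _ (h x hx) (p - q) q fun i j => by
    have := hpq (i + j) j
    rwa [show i + j + p = i + (p - q) + (j + q) by ring] at this
  omega

/-! ## Wang shifts as sets of configurations of indices -/

/-- The indices `a` and `b` are those of tiles that match horizontally. -/
def hRel (L : List (WangTile ℕ ℕ)) (a b : ℕ) : Bool :=
  (L.getD a ⟨0, 0, 0, 0⟩).right == (L.getD b ⟨0, 0, 0, 0⟩).left

/-- The indices `a` and `b` are those of tiles that match vertically. -/
def vRel (L : List (WangTile ℕ ℕ)) (a b : ℕ) : Bool :=
  (L.getD a ⟨0, 0, 0, 0⟩).top == (L.getD b ⟨0, 0, 0, 0⟩).bottom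

/-- The tilings of the plane by tiles in `L`, represented by the indices of tiles. -/
def indexTilings (L : List (WangTile ℕ ℕ)) : Set (ℤ → ℤ → ℕ) :=
  {x | IsTiling L.length (hRel L) (vRel L) x}

theorem isClosed_wangShift {I J : Type*} (T : Finset (WangTile I J)) : IsClosed (wangShift T) := by
  have : wangShift T = ⋂ n : ℤ × ℤ,
      ((fun x : Configuration T => (x n, x (n + (1, 0)))) ⁻¹' {p | p.1.1.right = p.2.1.left}) ∩
      ((fun x : Configuration T => (x n, x (n + (0, 1)))) ⁻¹' {p | p.1.1.top = p.2.1.bottom}) := by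
    ext x
    simp [wangShift]
  rw [this]
  exact isClosed_iInter fun n => IsClosed.inter
    ((isClosed_discrete _).preimage (by fun_prop)) ((isClosed_discrete _).preimage (by fun_prop))

theorem isShiftInvariant_wangShift {I J : Type*} (T : Finset (WangTile I J)) :
    IsShiftInvariant (wangShift T) := by
  have key : ∀ n, ∀ x ∈ wangShift T, shift n x ∈ wangShift T := by
    intro n x hx m
    simp only [shift]
    rw [add_right_comm m (1, 0), add_right_comm m (0, 1)]
    exact hx (m + n)
  intro n
  ext x
  constructor
  · rintro ⟨y, hy, rfl⟩
    exact key n y hy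
  · intro hx
    exact ⟨shift (-n) x, key _ x hx, by ext m; simp [shift]⟩

theorem isAperiodic_and_isMinimalSubshift_wangShift {L : List (WangTile ℕ ℕ)}
    {T : Finset (WangTile ℕ ℕ)} (hT : T = L.toFinset) (hne : (indexTilings L).Nonempty)
    (hper : NoPeriods (indexTilings L)) (hunif : UniformLanguage (indexTilings L)) :
    IsAperiodic (wangShift T) ∧ IsMinimalSubshift (wangShift T) := by
  have hmem : ∀ t : T, t.1 ∈ L := fun t => by
    exact List.mem_toFinset.1 (hT ▸ t.2)
  have hget : ∀ t : T, L.getD (L.idxOf t.1) ⟨0, 0, 0, 0⟩ = t.1 := fun t => by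
    rw [List.getD_eq_getElem _ _ (List.idxOf_lt_length_of_mem (hmem t)), List.getElem_idxOf]
  have hinj : ∀ s t : T, L.idxOf s.1 = L.idxOf t.1 → s = t := fun s t hst => by
    apply Subtype.ext
    rw [← hget s, hst, hget t]
  have hidx : ∀ x ∈ wangShift T, (fun i j => L.idxOf (x (i, j)).1) ∈ indexTilings L := by
    intro x hx i j
    refine ⟨List.idxOf_lt_length_of_mem (hmem _), ?_, ?_⟩
    · simp only [hRel, hget, beq_iff_eq]; simpa using (hx (i, j)).1
    · simp only [vRel, hget, beq_iff_eq]; simpa using (hx (i, j)).2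
  refine ⟨⟨?_, ?_⟩, ⟨isClosed_wangShift T, isShiftInvariant_wangShift T⟩, ?_⟩
  · obtain ⟨x, hx⟩ := hne
    have hm : ∀ i j, L.getD (x i j) ⟨0, 0, 0, 0⟩ ∈ T := fun i j => by
      rw [hT, List.mem_toFinset, List.getD_eq_getElem _ _ (hx i j).1]
      exact List.getElem_mem _
    refine ⟨fun p => ⟨_, hm p.1 p.2⟩, fun p => ⟨?_, ?_⟩⟩
    · simpa [hRel] using (hx p.1 p.2).2.1
    · simpa [vRel] using (hx p.1 p.2).2.2
  · rintro x hx ⟨⟨p, q⟩, hn, hpq⟩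
    apply hn
    obtain ⟨rfl, rfl⟩ := hper _ (hidx x hx) p q fun i j => by
      have := congrFun hpq (i, j)
      simp only [shift, Prod.mk_add_mk] at this
      simp [this]
    rfl
  · rintro ⟨Y, ⟨y, hy⟩, hYX, hcl, hinv⟩
    refine hYX.2 fun x hx => ?_
    -- Larger and larger central patterns of `x` occur in `y`, so translates of `y` converge to `x`,
    -- and `x` lies in the closed invariant set `Y`.
    choose u v huv using hunif _ (hidx x hx) _ (hidx y (hYX.1 hy))
    refine hcl.mem_of_tendsto (b := Filter.atTop) (f := fun N => shift (u N, v N) y) ?_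
      (Filter.Eventually.of_forall fun N => ?_)
    · rw [tendsto_pi_nhds]
      rintro ⟨i, j⟩
      apply tendsto_const_nhds.congr'
      filter_upwards [Filter.eventually_ge_atTop (|i| + |j| + 1).toNat] with N hN
      have h1 := neg_abs_le i
      have h2 := neg_abs_le j
      have h3 := le_abs_self i
      have h4 := le_abs_self j
      exact (hinj _ _ (huv N i j (by omega) (by omega) (by omega) (by omega))).symm
    · rw [← hinv (u N, v N)]
      exact ⟨y, hy, rfl⟩

/-! ## Tables of dominoes and their reduction

A relation on the numbers below `n` is represented by the list of its rows, which are numbers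
used as sets of bits. -/

/-- Evaluates `n` before it is substituted into `k`. -/
def forceNat {α : Type*} (n : ℕ) (k : ℕ → α) : α :=
  match n with
  | 0 => k 0
  | m + 1 => k (m + 1)

@[simp]
theorem forceNat_eq {α : Type*} (n : ℕ) (k : ℕ → α) : forceNat n k = k n := by
  cases n <;> rfl

/-- Evaluates `l` before it is substituted into `k`. -/
def forceList : List ℕ → (List ℕ → Bool) → Bool
  | [], k => k []
  | a :: l, k => forceNat a fun a => forceList l fun l => k (a :: l)

@[simp]
theorem forceList_eq (l : List ℕ) (k : List ℕ → Bool) : forceList l k = k l := by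
  induction l generalizing k with
  | nil => rfl
  | cons a l ih => simp [forceList, ih]

/-- The relation with table `R`. -/
def rel (R : List ℕ) (a b : ℕ) : Bool := (R.getD a 0).testBit b

/-- The set of the numbers `b < n` with `f b`. -/
def mask (f : ℕ → Bool) : ℕ → ℕ
  | 0 => 0
  | n + 1 => mask f n ||| cond (f n) (1 <<< n) 0

theorem testBit_mask {f : ℕ → Bool} {n b : ℕ} (hb : b < n) : (mask f n).testBit b = f b := by
  have h0 : ∀ n b, n ≤ b → (mask f n).testBit b = false := by
    intro n
    induction n with
    | zero => simp [mask]
    | succ n ih =>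
      intro b hb
      rw [mask, Nat.testBit_or, ih b (by omega)]
      cases f n
      · simp
      · simp [Nat.one_shiftLeft, show n ≠ b by omega]
  induction n with
  | zero => omega
  | succ n ih =>
    rw [mask, Nat.testBit_or]
    rcases (show b ≤ n by omega).lt_or_eq with h | rfl
    · rw [ih h]
      cases f n
      · simp
      · simp [Nat.one_shiftLeft, show n ≠ b by omega]
    · rw [h0 b b le_rfl]
      cases h1 : f b
      · simp
      · simp [Nat.one_shiftLeft]

/-- The table of `f` on the numbers below `n`. -/
def tabulate (n : ℕ) (f : ℕ → ℕ → Bool) : List ℕ := (List.range n).map fun a => mask (f a) n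

theorem rel_tabulate {n : ℕ} {f : ℕ → ℕ → Bool} {a b : ℕ} (ha : a < n) (hb : b < n) :
    rel (tabulate n f) a b = f a b := by
  rw [rel, tabulate, List.getD_eq_getElem _ _ (by simpa using ha)]
  simp [testBit_mask hb]

/-- The union of the rows of `H` with indices below `n` in the set `r`. -/
def unionRows (H : List ℕ) (r : ℕ) : ℕ → ℕ
  | 0 => 0
  | n + 1 => cond (r.testBit n) (unionRows H r n ||| H.getD n 0) (unionRows H r n)

theorem testBit_unionRows {H : List ℕ} {r n c d : ℕ} (hc : c < n) (hr : r.testBit c = true)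
    (h : rel H c d = true) : (unionRows H r n).testBit d = true := by
  induction n with
  | zero => omega
  | succ n ih =>
    rw [unionRows]
    rcases (show c ≤ n by omega).lt_or_eq with h1 | rfl
    · have := ih h1
      cases r.testBit n <;> simp [this]
    · rw [hr, cond_true, Nat.testBit_or]
      rw [rel] at h
      rw [h, Bool.or_true]

/-- The pairs related by `H` which have `V`-successors related by `H`. -/
def extendable (n : ℕ) (H V : List ℕ) : List ℕ :=
  (List.range n).map fun a =>
    forceNat (unionRows H (V.getD a 0) n) fun u => forceNat (H.getD a 0) fun r =>
      mask (fun b => r.testBit b && (u &&& V.getD b 0) != 0) n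

theorem rel_extendable {n : ℕ} {H V : List ℕ} {a b c d : ℕ} (ha : a < n) (hb : b < n) (hc : c < n)
    (hab : rel H a b = true) (hac : rel V a c = true) (hbd : rel V b d = true)
    (hcd : rel H c d = true) : rel (extendable n H V) a b = true := by
  rw [rel, extendable, List.getD_eq_getElem _ _ (by simpa using ha)]
  simp only [List.getElem_map, List.getElem_range, forceNat_eq]
  rw [testBit_mask hb, Bool.and_eq_true]
  refine ⟨hab, ?_⟩
  rw [bne_iff_ne]
  intro h0
  have := congrArg (fun z => z.testBit d) h0
  simp only [Nat.testBit_and, testBit_unionRows hc hac hcd, Nat.zero_testBit, Bool.true_and] at this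
  rw [rel] at hbd
  rw [hbd] at this
  cases this

/-- The table of the transposed relation. -/
def transposeTable (n : ℕ) (V : List ℕ) : List ℕ := tabulate n fun a b => rel V b a

/-- Applies `k` to the tables obtained from `H` and `V` by `r` rounds of deletions of dominoes that
have no neighbours. -/
def prune (n : ℕ) : ℕ → List ℕ → List ℕ → (List ℕ → List ℕ → Bool) → Bool
  | 0, H, V, k => k H V
  | r + 1, H, V, k =>
    forceList (transposeTable n V) fun Vt =>
    forceList (extendable n H V) fun H₁ =>
    forceList (extendable n H₁ Vt) fun H₂ =>
    forceList (transposeTable n H₂) fun Ht =>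
    forceList (extendable n V H₂) fun V₁ =>
    forceList (extendable n V₁ Ht) fun V₂ =>
    prune n r H₂ V₂ k

/-- A domino of a tiling of the plane is a side of two `2 × 2` squares of that tiling, one on each
side of it. These squares supply the neighbours that `extendable` asks for, with transposed tables
for those below and to the left. -/
theorem exists_of_prune {n r : ℕ} {H V : List ℕ} {k : List ℕ → List ℕ → Bool}
    (h : prune n r H V k = true) : ∃ H' V', k H' V' = true ∧
      ∀ x, IsTiling n (rel H) (rel V) x → IsTiling n (rel H') (rel V') x := by
  induction r generalizing H V with
  | zero => exact ⟨H, V, h, fun _ hx => hx⟩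
  | succ r ih =>
    simp only [prune, forceList_eq] at h
    obtain ⟨H', V', hk, hx'⟩ := ih h
    refine ⟨H', V', hk, fun x hx => hx' x ?_⟩
    have hlt : ∀ i j, x i j < n := fun i j => (hx i j).1
    have hV : ∀ i j, rel V (x i j) (x i (j + 1)) = true := fun i j => (hx i j).2.2
    have hVt : ∀ i j, rel (transposeTable n V) (x i (j + 1)) (x i j) = true := fun i j => by
      rw [transposeTable, rel_tabulate (hlt _ _) (hlt _ _)]; exact hV i j
    have hH₁ : ∀ i j, rel (extendable n H V) (x i j) (x (i + 1) j) = true := fun i j =>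
      rel_extendable (hlt _ _) (hlt _ _) (hlt _ _) (hx i j).2.1 (hV i j) (hV (i + 1) j)
        (hx i (j + 1)).2.1
    have hH₂ : ∀ i j, rel (extendable n (extendable n H V) (transposeTable n V))
        (x i j) (x (i + 1) j) = true := fun i j => by
      have e1 := hVt i (j - 1)
      have e2 := hVt (i + 1) (j - 1)
      rw [sub_add_cancel] at e1 e2
      exact rel_extendable (hlt _ _) (hlt _ _) (hlt _ _) (hH₁ i j) e1 e2 (hH₁ i (j - 1))
    generalize extendable n (extendable n H V) (transposeTable n V) = H₂ at *
    have hHt : ∀ i j, rel (transposeTable n H₂) (x (i + 1) j) (x i j) = true := fun i j => by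
      rw [transposeTable, rel_tabulate (hlt _ _) (hlt _ _)]; exact hH₂ i j
    have hV₁ : ∀ i j, rel (extendable n V H₂) (x i j) (x i (j + 1)) = true := fun i j =>
      rel_extendable (hlt _ _) (hlt _ _) (hlt _ _) (hV i j) (hH₂ i j) (hH₂ i (j + 1))
        (hV (i + 1) j)
    refine fun i j => ⟨hlt i j, hH₂ i j, ?_⟩
    have e1 := hHt (i - 1) j
    have e2 := hHt (i - 1) (j + 1)
    rw [sub_add_cancel] at e1 e2
    exact rel_extendable (hlt _ _) (hlt _ _) (hlt _ _) (hV₁ i j) e1 e2 (hV₁ (i - 1) j)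

/-- Applies `k` to tables of the dominoes of tiles in `L`, except for some which do not occur in
tilings of the plane. -/
def pruneTiles (L : List (WangTile ℕ ℕ)) (r : ℕ) (k : List ℕ → List ℕ → Bool) : Bool :=
  forceList (tabulate L.length (hRel L)) fun H =>
  forceList (tabulate L.length (vRel L)) fun V =>
  prune L.length r H V k

theorem exists_of_pruneTiles {L : List (WangTile ℕ ℕ)} {r : ℕ} {k : List ℕ → List ℕ → Bool}
    (h : pruneTiles L r k = true) : ∃ H V, k H V = true ∧
      indexTilings L ⊆ {x | IsTiling L.length (rel H) (rel V) x} := by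
  simp only [pruneTiles, forceList_eq] at h
  obtain ⟨H, V, hk, hx⟩ := exists_of_prune h
  refine ⟨H, V, hk, fun x hx' => hx x fun i j => ⟨(hx' i j).1, ?_, ?_⟩⟩
  · rw [rel_tabulate (hx' i j).1 (hx' (i + 1) j).1]; exact (hx' i j).2.1
  · rw [rel_tabulate (hx' i j).1 (hx' i (j + 1)).1]; exact (hx' i j).2.2

/-- The conditions of `IsFusion` concern the dominoes of tilings of the plane, so it is enough to
test them on the pruned tables. The target, in contrast, carries the full matching relations of
`L'`. -/
theorem desubstitutes_ofRows {L L' : List (WangTile ℕ ℕ)} {s : List (List ℕ)} {M : List ℕ} (r : ℕ)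
    (h : pruneTiles L r (fun H V => decide (IsFusion L.length (rel H) (rel V) M.contains s
      L'.length (hRel L') (vRel L'))) = true) :
    Desubstitutes (Expansion.ofRows s) (indexTilings L) (indexTilings L') := by
  obtain ⟨H, V, hk, hx⟩ := exists_of_pruneTiles h
  exact fun x hx' => (of_decide_eq_true hk).desubstitutes x (hx hx')

theorem desubstitutes_ofColumns {L L' : List (WangTile ℕ ℕ)} {s : List (List ℕ)} {M : List ℕ}
    (r : ℕ) (h : pruneTiles L r (fun H V => decide (IsFusion L.length (rel V) (rel H) M.contains s
      L'.length (vRel L') (hRel L'))) = true) :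
    Desubstitutes (Expansion.ofColumns s) (indexTilings L) (indexTilings L') := by
  obtain ⟨H, V, hk, hx⟩ := exists_of_pruneTiles h
  have := ((of_decide_eq_true hk).desubstitutes (m := L.length)).reflect
  rw [reflect_isTiling, reflect_isTiling] at this
  exact fun x hx' => this x (hx hx')

/-- Evaluates `l` before it is substituted into `k`. -/
def forceBlocks : List (ℕ × ℕ × ℕ × ℕ) → (List (ℕ × ℕ × ℕ × ℕ) → Bool) → Bool
  | [], k => k []
  | (a, b, c, d) :: l, k => forceNat a fun a => forceNat b fun b => forceNat c fun c =>
      forceNat d fun d => forceBlocks l fun l => k ((a, b, c, d) :: l)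

@[simp]
theorem forceBlocks_eq (l : List (ℕ × ℕ × ℕ × ℕ)) (k : List (ℕ × ℕ × ℕ × ℕ) → Bool) :
    forceBlocks l k = k l := by
  induction l generalizing k with
  | nil => rfl
  | cons a l ih => simp [forceBlocks, ih]

/-- Applies `k` to the patterns in the `r`-fold image of the patterns in `l`. -/
def iterateSubBlocks (E : Expansion) : ℕ → List (ℕ × ℕ × ℕ × ℕ) →
    (List (ℕ × ℕ × ℕ × ℕ) → Bool) → Bool
  | 0, l, k => k l
  | r + 1, l, k => forceBlocks (E.subBlocksOf l) fun l => iterateSubBlocks E r l k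

theorem iterateSubBlocks_eq (E : Expansion) (r : ℕ) (l : List (ℕ × ℕ × ℕ × ℕ))
    (k : List (ℕ × ℕ × ℕ × ℕ) → Bool) : iterateSubBlocks E r l k = k (E.subBlocksOf^[r] l) := by
  induction r generalizing l with
  | zero => rfl
  | succ r ih => simp [iterateSubBlocks, ih]

/-! ## Lists of tiles -/

/-- The tiles in `tiles5`. -/
def tileList5 : List (WangTile ℕ ℕ) := [
  ⟨2113, 5, 2130, 1⟩, ⟨2130, 1, 2103, 5⟩, ⟨2133, 1, 2113, 1⟩, ⟨2113, 5, 2330, 0⟩,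
  ⟨2130, 6, 2300, 0⟩, ⟨2103, 5, 2310, 0⟩, ⟨2310, 1, 2033, 6⟩, ⟨2300, 1, 2033, 6⟩,
  ⟨2300, 0, 2030, 6⟩, ⟨2030, 1, 2103, 0⟩, ⟨2033, 1, 2113, 0⟩, ⟨2330, 1, 2133, 6⟩,
  ⟨2330, 0, 2130, 6⟩, ⟨21113, 5, 21330, 1⟩, ⟨21130, 6, 21300, 1⟩, ⟨21103, 5, 21310, 1⟩,
  ⟨21310, 1, 21033, 5⟩, ⟨21310, 0, 21030, 5⟩, ⟨21300, 1, 21033, 5⟩, ⟨21300, 0, 21030, 5⟩,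
  ⟨21030, 1, 21103, 1⟩, ⟨21033, 1, 21113, 1⟩, ⟨21330, 0, 21130, 1⟩, ⟨21330, 0, 21130, 5⟩,
  ⟨21130, 6, 23300, 0⟩, ⟨21030, 6, 23100, 0⟩, ⟨23100, 0, 20330, 6⟩, ⟨20330, 0, 21130, 0⟩,
  ⟨23300, 0, 21330, 6⟩]

/-- The tiles in `tiles6`. -/
def tileList6 : List (WangTile ℕ ℕ) := [
  ⟨21131, 1, 21305, 1⟩, ⟨21305, 5, 21031, 5⟩, ⟨21331, 1, 21131, 1⟩, ⟨21131, 1, 23305, 0⟩,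
  ⟨21300, 0, 23006, 0⟩, ⟨21031, 1, 23105, 0⟩, ⟨23105, 5, 20331, 6⟩, ⟨23006, 6, 20331, 6⟩,
  ⟨23006, 6, 20300, 6⟩, ⟨20300, 0, 21031, 0⟩, ⟨20331, 1, 21131, 0⟩, ⟨23305, 5, 21331, 6⟩,
  ⟨23305, 5, 21300, 6⟩, ⟨211131, 1, 213305, 1⟩, ⟨211300, 0, 213006, 1⟩, ⟨211031, 1, 213105, 1⟩,
  ⟨213105, 5, 210331, 5⟩, ⟨213105, 5, 210300, 5⟩, ⟨213006, 6, 210331, 5⟩,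
  ⟨213006, 6, 210300, 5⟩, ⟨210300, 0, 211031, 1⟩, ⟨210331, 1, 211131, 1⟩,
  ⟨213300, 0, 211300, 1⟩, ⟨213305, 5, 211300, 5⟩, ⟨211300, 0, 233006, 0⟩,
  ⟨210300, 0, 231006, 0⟩, ⟨231006, 6, 203300, 6⟩, ⟨203300, 0, 211300, 0⟩,
  ⟨233006, 6, 213300, 6⟩]

/-- The tiles in `tiles7`. -/
def tileList7 : List (WangTile ℕ ℕ) := [
  ⟨21331, 1, 21131, 1⟩, ⟨20300, 0, 21031, 0⟩, ⟨20331, 1, 21131, 0⟩, ⟨210300, 0, 211031, 1⟩,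
  ⟨210331, 1, 211131, 1⟩, ⟨213300, 0, 211300, 1⟩, ⟨203300, 0, 211300, 0⟩,
  ⟨21131, 51, 21031, 51⟩, ⟨21031, 51, 20331, 60⟩, ⟨21300, 60, 20331, 60⟩,
  ⟨21300, 60, 20300, 60⟩, ⟨21131, 51, 21331, 60⟩, ⟨21131, 51, 21300, 60⟩,
  ⟨211031, 51, 210331, 51⟩, ⟨211031, 51, 210300, 51⟩, ⟨211300, 60, 210331, 51⟩,
  ⟨211300, 60, 210300, 51⟩, ⟨211131, 51, 211300, 51⟩, ⟨210300, 60, 203300, 60⟩,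
  ⟨211300, 60, 213300, 60⟩]

/-- The tiles in `tiles8`. -/
def tileList8 : List (WangTile ℕ ℕ) := [
  ⟨21031, 51, 20331, 60⟩, ⟨21300, 60, 20331, 60⟩, ⟨21300, 60, 20300, 60⟩,
  ⟨211300, 60, 210331, 51⟩, ⟨211300, 60, 210300, 51⟩, ⟨210300, 60, 203300, 60⟩,
  ⟨211300, 60, 213300, 60⟩, ⟨21331, 511, 21031, 511⟩, ⟨20331, 511, 21031, 510⟩,
  ⟨20300, 510, 20331, 600⟩, ⟨20331, 511, 21331, 600⟩, ⟨20331, 511, 21300, 600⟩,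
  ⟨210300, 510, 210331, 511⟩, ⟨210300, 510, 210300, 511⟩, ⟨213300, 600, 210331, 511⟩,
  ⟨203300, 600, 210331, 510⟩, ⟨213300, 600, 210300, 511⟩, ⟨203300, 600, 210300, 510⟩,
  ⟨210331, 511, 211300, 511⟩, ⟨203300, 600, 213300, 600⟩]

/-- The tiles in `tiles9`. -/
def tileList9 : List (WangTile ℕ ℕ) := [
  ⟨211300, 60, 210331, 51⟩, ⟨211300, 60, 210300, 51⟩, ⟨210300, 60, 203300, 60⟩,
  ⟨211300, 60, 213300, 60⟩, ⟨210300, 510, 210331, 511⟩, ⟨210300, 510, 210300, 511⟩,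
  ⟨213300, 600, 210331, 511⟩, ⟨203300, 600, 210331, 510⟩, ⟨210331, 511, 211300, 511⟩,
  ⟨21130021031, 51, 21030020331, 51⟩, ⟨21030021031, 51, 20330020331, 60⟩,
  ⟨21030021300, 60, 20330020331, 60⟩, ⟨21030021300, 60, 20330020300, 60⟩,
  ⟨21130021031, 51, 21330020331, 60⟩, ⟨21030020331, 511, 21030021031, 511⟩,
  ⟨21330020331, 511, 21033121331, 511⟩, ⟨20330020331, 511, 21033121331, 510⟩,
  ⟨21330020331, 511, 21030021300, 511⟩, ⟨20330020300, 510, 21030020331, 510⟩,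
  ⟨20330020331, 511, 21030021300, 510⟩, ⟨21033121331, 511, 21130021031, 511⟩,
  ⟨20330020300, 510, 21330020331, 600⟩]

/-- The tiles in `tiles10`. -/
def tileList10 : List (WangTile ℕ ℕ) := [
  ⟨210331, 511, 211300, 511⟩, ⟨21030020331, 511, 21030021031, 511⟩,
  ⟨21330020331, 511, 21030021300, 511⟩, ⟨21033121331, 511, 21130021031, 511⟩,
  ⟨211300, 51060, 210331, 51151⟩, ⟨211300, 51060, 210300, 51151⟩,
  ⟨211300, 60060, 210331, 51160⟩, ⟨210300, 60060, 210331, 51060⟩,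
  ⟨211300, 51160, 211300, 51151⟩, ⟨21130021031, 51151, 21030021031, 51151⟩,
  ⟨21130021031, 51151, 21033121331, 51160⟩, ⟨21030021031, 51151, 21033121331, 51060⟩,
  ⟨21030021300, 51160, 21033121331, 51060⟩, ⟨21130021031, 51151, 21030021300, 51160⟩,
  ⟨21030021300, 51060, 21030020331, 51060⟩, ⟨21030021031, 51151, 21030021300, 51060⟩,
  ⟨21030021300, 51160, 21030021300, 51060⟩, ⟨21030021300, 51060, 21330020331, 60060⟩]

/-- The tiles in `tiles11`. -/
def tileList11 : List (WangTile ℕ ℕ) := [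
  ⟨21030020331, 511, 21030021031, 511⟩, ⟨21330020331, 511, 21030021300, 511⟩,
  ⟨21033121331, 511, 21130021031, 511⟩, ⟨21030021300, 51160, 21033121331, 51060⟩,
  ⟨21130021031, 51151, 21030021300, 51160⟩, ⟨21030021300, 51060, 21030020331, 51060⟩,
  ⟨21030021031, 51151, 21030021300, 51060⟩, ⟨21030021300, 51160, 21030021300, 51060⟩,
  ⟨21030021300, 51060, 21330020331, 60060⟩, ⟨21030020331210331, 511, 21030021031211300, 511⟩,
  ⟨21330020331210331, 511, 21030021300211300, 511⟩,
  ⟨21033121331210331, 511, 21130021031211300, 511⟩,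
  ⟨21130021031211300, 51160, 21030021031211300, 51151⟩,
  ⟨21130021031211300, 51060, 21033121331210331, 51160⟩,
  ⟨21030021031211300, 51060, 21033121331210331, 51060⟩,
  ⟨21030021300211300, 60060, 21033121331210331, 51060⟩,
  ⟨21130021031211300, 51060, 21030021300210300, 51160⟩,
  ⟨21130021031211300, 51160, 21030021300211300, 51160⟩,
  ⟨21030021300210300, 60060, 21030020331210331, 51060⟩,
  ⟨21030021031211300, 51060, 21030021300210300, 51060⟩,
  ⟨21030021300210300, 60060, 21330020331210331, 60060⟩]

/-- The tiles in `tiles12`. -/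
def tileList12 : List (WangTile ℕ ℕ) := [
  ⟨21030021300, 51060, 21030020331, 51060⟩, ⟨21030021300, 51060, 21330020331, 60060⟩,
  ⟨21030021031211300, 51060, 21033121331210331, 51060⟩,
  ⟨21030021300211300, 60060, 21033121331210331, 51060⟩,
  ⟨21030021300210300, 60060, 21030020331210331, 51060⟩,
  ⟨21030021300210300, 60060, 21330020331210331, 60060⟩,
  ⟨21330020331, 51160511, 21033121331, 51060511⟩,
  ⟨21033121331, 51151511, 21030021300, 51160511⟩,
  ⟨21330020331, 51060511, 21030020331, 51060511⟩,
  ⟨21030020331, 51151511, 21030021300, 51060511⟩,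
  ⟨21330020331, 51160511, 21030021300, 51060511⟩,
  ⟨21330020331, 51060511, 21330020331, 60060511⟩,
  ⟨21033121331210331, 51160511, 21030021031211300, 51151511⟩,
  ⟨21033121331210331, 51060511, 21033121331210331, 51160511⟩,
  ⟨21030020331210331, 51060511, 21033121331210331, 51060511⟩,
  ⟨21330020331210331, 60060511, 21033121331210331, 51060511⟩,
  ⟨21033121331210331, 51060511, 21030021300210300, 51160511⟩,
  ⟨21033121331210331, 51160511, 21030021300211300, 51160511⟩,
  ⟨21030020331210331, 51060511, 21030021300210300, 51060511⟩]

/-- The tiles obtained from those in `tiles12` by fusing rows. -/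
def tileList13 : List (WangTile ℕ ℕ) := [
  ⟨21030021031211300, 51060, 21033121331210331, 51060⟩,
  ⟨21030021300211300, 60060, 21033121331210331, 51060⟩,
  ⟨21030021300210300, 60060, 21030020331210331, 51060⟩,
  ⟨21033121331210331, 51160511, 21030021031211300, 51151511⟩,
  ⟨21033121331210331, 51060511, 21033121331210331, 51160511⟩,
  ⟨21030020331210331, 51060511, 21033121331210331, 51060511⟩,
  ⟨21033121331210331, 51060511, 21030021300210300, 51160511⟩,
  ⟨21033121331210331, 51160511, 21030021300211300, 51160511⟩,
  ⟨2103002103121130021030021300, 51060, 2103312133121033121030020331, 51060⟩,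
  ⟨2103002130021130021030021300, 51060, 2103312133121033121330020331, 51060⟩,
  ⟨2103002130021030021030021300, 51060, 2103002033121033121330020331, 51060⟩,
  ⟨2103002130021030021030021300, 51060, 2133002033121033121330020331, 60060⟩,
  ⟨2103312133121033121033121331, 51151511, 2103002103121130021030021300, 51151511⟩,
  ⟨2103312133121033121330020331, 51160511, 2103312133121033121033121331, 51160511⟩,
  ⟨2103002033121033121330020331, 51160511, 2103312133121033121033121331, 51060511⟩,
  ⟨2103002033121033121330020331, 51060511, 2103312133121033121030020331, 51060511⟩,
  ⟨2133002033121033121330020331, 51060511, 2103312133121033121330020331, 51060511⟩,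
  ⟨2103312133121033121030020331, 51151511, 2103002130021030021030021300, 51160511⟩,
  ⟨2103312133121033121330020331, 51160511, 2103002130021030021030021300, 51160511⟩,
  ⟨2103312133121033121033121331, 51151511, 2103002130021130021030021300, 51160511⟩,
  ⟨2103002033121033121330020331, 51160511, 2103002130021030021030021300, 51060511⟩]

/-! ## Words fused to single tiles -/

/-- The rows of tiles in `tileList6` fused to the tiles in `tileList7`. -/
def fusedWords6 : List (List ℕ) := [
  [2], [9], [10], [20], [21], [22], [27], [1, 0], [6, 5], [7, 4], [8, 4], [11, 3], [12, 3],
  [16, 15], [17, 15], [18, 14], [19, 14], [23, 13], [26, 25], [28, 24]]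

/-- The rows of tiles in `tileList7` fused to the tiles in `tileList8`. -/
def fusedWords7 : List (List ℕ) := [
  [8], [9], [10], [15], [16], [18], [19], [7, 0], [7, 2], [8, 1], [11, 2], [12, 2], [13, 3],
  [14, 3], [15, 5], [15, 6], [16, 5], [16, 6], [17, 4], [19, 6]]

/-- The columns of tiles in `tileList8` fused to the tiles in `tileList9`. -/
def fusedWords8 : List (List ℕ) := [
  [3], [4], [5], [6], [12], [13], [14], [15], [18], [4, 0], [5, 0], [5, 1], [5, 2], [6, 0],
  [13, 8], [14, 10], [15, 10], [16, 11], [17, 9], [17, 11], [18, 7], [19, 9]]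

/-- The rows of tiles in `tileList9` fused to the tiles in `tileList10`. -/
def fusedWords9 : List (List ℕ) := [
  [8], [14], [17], [20], [4, 1], [5, 1], [6, 3], [7, 2], [8, 0], [14, 9], [15, 13], [16, 10],
  [16, 11], [17, 13], [18, 12], [19, 10], [19, 11], [21, 12]]

/-- The columns of tiles in `tileList10` fused to the tiles in `tileList11`. -/
def fusedWords10 : List (List ℕ) := [
  [1], [2], [3], [12], [13], [14], [15], [16], [17], [1, 0], [2, 0], [3, 0], [9, 8], [10, 4],
  [11, 4], [12, 6], [13, 5], [13, 8], [14, 7], [15, 5], [17, 7]]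

/-- The rows of tiles in `tileList11` fused to the tiles in `tileList12`. -/
def fusedWords11 : List (List ℕ) := [
  [5], [8], [14], [15], [18], [20], [3, 1], [4, 2], [5, 1], [6, 0], [7, 1], [8, 1], [12, 11],
  [13, 11], [14, 9], [15, 10], [16, 11], [17, 11], [19, 9]]

/-- The columns of tiles in `tileList12` fused to the tiles in `tileList13`. -/
def fusedWords12 : List (List ℕ) := [
  [2], [3], [4], [12], [13], [14], [16], [17], [2, 0], [3, 1], [4, 1], [5, 1], [12, 7],
  [13, 6], [14, 6], [14, 8], [15, 11], [16, 9], [16, 10], [17, 7], [18, 10]]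

/-- The rows of tiles in `tileList13` fused to the tiles in `tileList12`. -/
def fusedWords13 : List (List ℕ) := [
  [7], [3], [18], [17], [19], [12], [6, 0], [5, 2], [7, 0], [4, 1], [4, 0], [3, 0], [16, 11],
  [20, 10], [18, 9], [17, 8], [14, 10], [15, 10], [13, 9]]

/-! ### Verification of the fusions and of their liftings -/

theorem desubstitutes6 : Desubstitutes (Expansion.ofRows fusedWords6)
    (indexTilings tileList6) (indexTilings tileList7) :=
  desubstitutes_ofRows (M := [0, 3, 4, 5, 13, 14, 15, 24, 25]) 5 (by decide +kernel)

theorem lifts6 : (Expansion.ofRows fusedWords6).Lifts tileList7.length (hRel tileList7)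
    (vRel tileList7) tileList6.length (hRel tileList6) (vRel tileList6) := by
  decide +kernel

theorem desubstitutes7 : Desubstitutes (Expansion.ofRows fusedWords7)
    (indexTilings tileList7) (indexTilings tileList8) :=
  desubstitutes_ofRows (M := [0, 1, 2, 3, 4, 5, 6]) 5 (by decide +kernel)

theorem lifts7 : (Expansion.ofRows fusedWords7).Lifts tileList8.length (hRel tileList8)
    (vRel tileList8) tileList7.length (hRel tileList7) (vRel tileList7) := by
  decide +kernel

theorem desubstitutes8 : Desubstitutes (Expansion.ofColumns fusedWords8)
    (indexTilings tileList8) (indexTilings tileList9) :=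
  desubstitutes_ofColumns (M := [0, 1, 2, 7, 8, 9, 10, 11]) 5 (by decide +kernel)

theorem lifts8 : (Expansion.ofColumns fusedWords8).Lifts tileList9.length (hRel tileList9)
    (vRel tileList9) tileList8.length (hRel tileList8) (vRel tileList8) := by
  decide +kernel

theorem desubstitutes9 : Desubstitutes (Expansion.ofRows fusedWords9)
    (indexTilings tileList9) (indexTilings tileList10) :=
  desubstitutes_ofRows (M := [0, 1, 2, 3, 9, 10, 11, 12, 13]) 5 (by decide +kernel)

theorem lifts9 : (Expansion.ofRows fusedWords9).Lifts tileList10.length (hRel tileList10)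
    (vRel tileList10) tileList9.length (hRel tileList9) (vRel tileList9) := by
  decide +kernel

theorem desubstitutes10 : Desubstitutes (Expansion.ofColumns fusedWords10)
    (indexTilings tileList10) (indexTilings tileList11) :=
  desubstitutes_ofColumns (M := [0, 4, 5, 6, 7, 8]) 5 (by decide +kernel)

theorem lifts10 : (Expansion.ofColumns fusedWords10).Lifts tileList11.length (hRel tileList11)
    (vRel tileList11) tileList10.length (hRel tileList10) (vRel tileList10) := by
  decide +kernel

theorem desubstitutes11 : Desubstitutes (Expansion.ofRows fusedWords11)
    (indexTilings tileList11) (indexTilings tileList12) :=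
  desubstitutes_ofRows (M := [0, 1, 2, 9, 10, 11]) 5 (by decide +kernel)

theorem lifts11 : (Expansion.ofRows fusedWords11).Lifts tileList12.length (hRel tileList12)
    (vRel tileList12) tileList11.length (hRel tileList11) (vRel tileList11) := by
  decide +kernel

theorem desubstitutes12 : Desubstitutes (Expansion.ofColumns fusedWords12)
    (indexTilings tileList12) (indexTilings tileList13) :=
  desubstitutes_ofColumns (M := [0, 1, 6, 7, 8, 9, 10, 11]) 5 (by decide +kernel)

/-- The return to `tileList12` closes the loop. Fusion compares only matching relations between
indices, so the longer color words produced by fusing are silently replaced by those of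
`tileList12`; the order of `fusedWords13` encodes this renaming. -/
theorem desubstitutes13 : Desubstitutes (Expansion.ofRows fusedWords13)
    (indexTilings tileList13) (indexTilings tileList12) :=
  desubstitutes_ofRows (M := [0, 1, 2, 8, 9, 10, 11]) 5 (by decide +kernel)

/-! ## The self-similarity of the tilings by `tiles12` -/

/-- The expansion which maps the tilings by `tiles12` onto themselves up to shifts. -/
def expansion12 : Expansion :=
  (Expansion.ofColumns fusedWords12).comp (Expansion.ofRows fusedWords13)

theorem expansion12_pos {c : ℕ} (hc : c < 19) : 1 ≤ expansion12.w c ∧ 1 ≤ expansion12.h c := by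
  have : ∀ c < 19, 1 ≤ expansion12.w c ∧ 1 ≤ expansion12.h c := by decide +kernel
  exact this c hc

theorem desubstitutes_expansion12 :
    Desubstitutes expansion12 (indexTilings tileList12) (indexTilings tileList12) :=
  desubstitutes12.comp (fun _ _ _ _ => rfl) (fun _ _ _ _ => rfl)
    (fun _ hz i j => (expansion12_pos (hz i j).1).1) desubstitutes13

theorem posOn_expansion12 : expansion12.PosOn (indexTilings tileList12) :=
  fun _ hx i j => expansion12_pos (hx i j).1

theorem noThin_expansion12 : expansion12.NoThin (indexTilings tileList12) := by
  obtain ⟨H, V, h, hx⟩ := exists_of_pruneTiles (L := tileList12) (r := 3)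
    (k := fun H V => decide (∀ a < (19 : ℕ), ∀ b < (19 : ℕ),
      (rel H a b = true → 3 ≤ expansion12.w a + expansion12.w b) ∧
      (rel V a b = true → 3 ≤ expansion12.h a + expansion12.h b)))
    (by decide +kernel)
  have h := of_decide_eq_true h
  exact fun x hx' i j => ⟨(h _ (hx' i j).1 _ (hx' (i + 1) j).1).1 (hx hx' i j).2.1,
    (h _ (hx' i j).1 _ (hx' i (j + 1)).1).2 (hx hx' i j).2.2⟩

theorem noPeriods12 : NoPeriods (indexTilings tileList12) :=
  .of_selfSimilar desubstitutes_expansion12 posOn_expansion12 noThin_expansion12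

/-- The `2 × 2` patterns in tilings by `tiles12`. -/
def blocks12 : List (ℕ × ℕ × ℕ × ℕ) := [
  (0, 7, 2, 12), (1, 7, 2, 12), (1, 9, 2, 12), (1, 10, 3, 17), (1, 10, 4, 16), (2, 12, 0, 7),
  (2, 12, 3, 17), (2, 12, 4, 16), (3, 17, 1, 7), (3, 17, 5, 16), (4, 16, 1, 9), (4, 16, 1, 10),
  (4, 16, 5, 18), (5, 16, 1, 10), (5, 18, 1, 10), (6, 1, 13, 2), (6, 1, 13, 3), (7, 6, 12, 13),
  (8, 1, 14, 4), (9, 0, 12, 2), (9, 8, 12, 14), (10, 1, 16, 2), (10, 1, 16, 3), (10, 1, 17, 2),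
  (10, 11, 16, 14), (10, 11, 17, 14), (11, 1, 14, 4), (12, 2, 16, 3), (12, 13, 7, 6),
  (12, 13, 16, 14), (12, 13, 16, 15), (12, 13, 17, 14), (12, 14, 7, 6), (12, 14, 16, 15),
  (13, 2, 14, 4), (13, 3, 6, 1), (13, 3, 15, 5), (14, 4, 6, 1), (14, 4, 8, 1), (14, 4, 15, 5),
  (15, 5, 11, 1), (16, 2, 9, 0), (16, 2, 18, 4), (16, 3, 10, 1), (16, 14, 9, 8),
  (16, 15, 10, 11), (17, 2, 16, 3), (17, 14, 7, 6), (17, 14, 16, 15), (18, 4, 10, 1)]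
-- The pruned tables allow one pattern too many, `(5, 16, 1, 9)`. It is excluded by self-similarity:
-- every `2 × 2` pattern of a tiling lies in the image of an allowed one, and those images contain
-- only patterns of `blocks12`.
set_option synthInstance.maxSize 1000 in
theorem blockAt_mem_blocks12 {x : ℤ → ℤ → ℕ} (hx : x ∈ indexTilings tileList12) (i j : ℤ) :
    blockAt x i j ∈ blocks12 := by
  have key : ∀ x ∈ indexTilings tileList12, ∀ i j,
      blockAt x i j ∈ (5, 16, 1, 9) :: blocks12 := by
    obtain ⟨H, V, h, hx⟩ := exists_of_pruneTiles (L := tileList12) (r := 3)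
      (k := fun H V => decide (∀ a < (19 : ℕ), ∀ b < (19 : ℕ), rel H a b = true →
        ∀ c < (19 : ℕ), rel V a c = true → ∀ d < (19 : ℕ), rel V b d = true → rel H c d = true →
          ((5, 16, 1, 9) :: blocks12).contains (a, b, c, d) = true))
      (by decide +kernel)
    have h := of_decide_eq_true h
    exact fun x hx' i j => List.contains_iff_mem.1 <|
      h _ (hx' i j).1 _ (hx' (i + 1) j).1 (hx hx' i j).2.1 _
      (hx' i (j + 1)).1 (hx hx' i j).2.2 _ (hx' (i + 1) (j + 1)).1 (hx hx' (i + 1) j).2.2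
      (hx hx' i (j + 1)).2.1
  have hsub : ∀ c ∈ (5, 16, 1, 9) :: blocks12, ∀ d ∈ expansion12.subBlocks c, d ∈ blocks12 := by
    decide +kernel
  obtain ⟨y, hy, P, Q, hs, -⟩ := desubstitutes_expansion12 x hx
  obtain ⟨k, l, hkl⟩ := hs.exists_blockAt_mem (posOn_expansion12 y hy) i j
  exact hsub _ (key y hy k l) _ hkl

/-- Primitivity of the substitution on `2 × 2` patterns, in two stages: three iterations lead from
any pattern to `(1, 7, 2, 12)`, and five more lead from that one to all patterns. -/
theorem exists_blockAt_eq_of_mem_blocks12 {x : ℤ → ℤ → ℕ} (hx : x ∈ indexTilings tileList12)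
    {d : ℕ × ℕ × ℕ × ℕ} (hd : d ∈ blocks12) : ∃ i j, blockAt x i j = d := by
  have h₁ : ∀ c ∈ blocks12, (1, 7, 2, 12) ∈ expansion12.subBlocksOf^[3] [c] := by
    have : (blocks12.all fun c => iterateSubBlocks expansion12 3 [c] fun l =>
        decide ((1, 7, 2, 12) ∈ l)) = true := by decide +kernel
    simpa only [List.all_eq_true, iterateSubBlocks_eq, decide_eq_true_eq] using this
  have h₂ : ∀ d ∈ blocks12, d ∈ expansion12.subBlocksOf^[5] [(1, 7, 2, 12)] := by
    have : (iterateSubBlocks expansion12 5 [(1, 7, 2, 12)] fun l =>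
        decide (∀ d ∈ blocks12, d ∈ l)) = true := by decide +kernel
    simpa only [iterateSubBlocks_eq, decide_eq_true_eq] using this
  obtain ⟨c, hc, h⟩ := desubstitutes_expansion12.exists_blocks (S := [(1, 7, 2, 12)])
    (fun x hx => by
      obtain ⟨c, hc, h⟩ := desubstitutes_expansion12.exists_blocks (S := blocks12)
        (fun x hx => ⟨_, blockAt_mem_blocks12 hx 0 0, 0, 0, rfl⟩) 3 x hx
      exact ⟨_, List.mem_singleton_self _, h _ (h₁ c hc)⟩) 5 x hx
  rw [List.mem_singleton] at hc
  subst hc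
  exact h d (h₂ d hd)

theorem uniformLanguage12 : UniformLanguage (indexTilings tileList12) :=
  .of_selfSimilar (n := 19) desubstitutes_expansion12 posOn_expansion12
    (fun _ hx i j => (hx i j).1) (by decide +kernel)
    fun _ hx _ hx' i j => exists_blockAt_eq_of_mem_blocks12 hx' (blockAt_mem_blocks12 hx i j)

theorem nonempty12 : (indexTilings tileList12).Nonempty :=
  -- The image of the letter `12` has two columns and two rows, as the seed requires.
  nonempty_of_selfSimilar (E := expansion12) (c := 12) (by decide +kernel) (by decide +kernel)
    (by decide +kernel) (by decide +kernel) (by decide +kernel) (by decide +kernel)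

/-! ## The other sets of tiles -/

theorem Expansion.Lifts.posOn {E : Expansion} {L L' : List (WangTile ℕ ℕ)}
    (h : E.Lifts L'.length (hRel L') (vRel L') L.length (hRel L) (vRel L)) :
    E.PosOn (indexTilings L') :=
  fun _ hx i j => h.pos _ (hx i j).1

/-- The properties of a set of configurations which entail that the corresponding Wang shift is
aperiodic and minimal. -/
structure IsAperiodicMinimal (X : Set (ℤ → ℤ → ℕ)) : Prop where
  nonempty : X.Nonempty
  noPeriods : NoPeriods X
  uniformLanguage : UniformLanguage X

theorem IsAperiodicMinimal.of_desubstitutes {E : Expansion} {L L' : List (WangTile ℕ ℕ)}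
    (h : IsAperiodicMinimal (indexTilings L'))
    (hE : E.Lifts L'.length (hRel L') (vRel L') L.length (hRel L) (vRel L))
    (hd : Desubstitutes E (indexTilings L) (indexTilings L')) :
    IsAperiodicMinimal (indexTilings L) :=
  ⟨hE.nonempty h.nonempty, h.noPeriods.of_desubstitutes hd,
    h.uniformLanguage.of_desubstitutes hE.posOn hd⟩

theorem isAperiodicMinimal12 : IsAperiodicMinimal (indexTilings tileList12) :=
  ⟨nonempty12, noPeriods12, uniformLanguage12⟩

theorem isAperiodicMinimal11 : IsAperiodicMinimal (indexTilings tileList11) :=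
  isAperiodicMinimal12.of_desubstitutes lifts11 desubstitutes11

theorem isAperiodicMinimal10 : IsAperiodicMinimal (indexTilings tileList10) :=
  isAperiodicMinimal11.of_desubstitutes lifts10 desubstitutes10

theorem isAperiodicMinimal9 : IsAperiodicMinimal (indexTilings tileList9) :=
  isAperiodicMinimal10.of_desubstitutes lifts9 desubstitutes9

theorem isAperiodicMinimal8 : IsAperiodicMinimal (indexTilings tileList8) :=
  isAperiodicMinimal9.of_desubstitutes lifts8 desubstitutes8

theorem isAperiodicMinimal7 : IsAperiodicMinimal (indexTilings tileList7) :=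
  isAperiodicMinimal8.of_desubstitutes lifts7 desubstitutes7

theorem isAperiodicMinimal6 : IsAperiodicMinimal (indexTilings tileList6) :=
  isAperiodicMinimal7.of_desubstitutes lifts6 desubstitutes6

/-- A tile of `tileList6` is the tile of `tileList5` with the same index in which the top color is
that of its right neighbour; this color is appended to the right color, and the tile's own old top
color to the left color. The new top color must therefore match the bottom of the tile diagonally
above to the right, which the shear places directly above. -/
theorem shear_mem_indexTilings_tileList6 {x : ℤ → ℤ → ℕ} (hx : x ∈ indexTilings tileList5) :
    (fun i j => x (i + j) j) ∈ indexTilings tileList6 := by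
  obtain ⟨H, V, h, hX⟩ := exists_of_pruneTiles (L := tileList5) (r := 2)
    (k := fun H V => decide (∀ a < (29 : ℕ), ∀ b < (29 : ℕ), rel H a b = true →
      hRel tileList6 a b = true ∧ ∀ c < (29 : ℕ), rel V b c = true → vRel tileList6 a c = true))
    (by decide +kernel)
  have h := of_decide_eq_true h
  intro i j
  have key := h _ (hx (i + j) j).1 _ (hx (i + j + 1) j).1 (hX hx (i + j) j).2.1
  refine ⟨(hx _ _).1, ?_, ?_⟩
  · simp only [add_right_comm i 1 j]; exact key.1
  · simp only [← add_assoc]; exact key.2 _ (hx _ _).1 (hX hx (i + j + 1) j).2.2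

theorem shear_mem_indexTilings_tileList5 {y : ℤ → ℤ → ℕ} (hy : y ∈ indexTilings tileList6) :
    (fun i j => y (i - j) j) ∈ indexTilings tileList5 := by
  -- No pruning is needed in this direction: the last digit of the color shared by `a` and `b` is
  -- both the top color of `a` in `tileList6` and that of `b` in `tileList5`.
  have h : ∀ a < 29, ∀ b < 29, hRel tileList6 a b = true → hRel tileList5 a b = true ∧
      ∀ c < 29, vRel tileList6 a c = true → vRel tileList5 b c = true := by decide +kernel
  intro i j
  refine ⟨(hy _ _).1, ?_, ?_⟩ <;> beta_reduce
  · have := (h _ (hy (i - j) j).1 _ (hy (i - j + 1) j).1 (hy (i - j) j).2.1).1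
    rwa [show i + 1 - j = i - j + 1 by ring]
  · have := (h _ (hy (i - (j + 1)) j).1 _ (hy (i - (j + 1) + 1) j).1 (hy (i - (j + 1)) j).2.1).2 _
      (hy _ (j + 1)).1 (hy (i - (j + 1)) j).2.2
    rwa [show i - (j + 1) + 1 = i - j by ring] at this

theorem isAperiodicMinimal5 : IsAperiodicMinimal (indexTilings tileList5) :=
  ⟨isAperiodicMinimal6.nonempty.elim fun _ hy => ⟨_, shear_mem_indexTilings_tileList5 hy⟩,
    noPeriods_of_shear (fun _ => shear_mem_indexTilings_tileList6) isAperiodicMinimal6.noPeriods,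
    uniformLanguage_of_shear (fun _ => shear_mem_indexTilings_tileList6)
      isAperiodicMinimal6.uniformLanguage⟩

theorem IsAperiodicMinimal.wangShift {L : List (WangTile ℕ ℕ)} {T : Finset (WangTile ℕ ℕ)}
    (h : IsAperiodicMinimal (indexTilings L)) (hT : T = L.toFinset) :
    IsAperiodic (wangShift T) ∧ IsMinimalSubshift (wangShift T) :=
  isAperiodic_and_isMinimalSubshift_wangShift hT h.nonempty h.noPeriods h.uniformLanguage

/-- For every `5 ≤ i ≤ 12`, the Wang shift `Ω_i` of the set `T_i` of Wang tiles is aperiodic and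
minimal. -/
theorem mainTheorem4 (i : ℕ) (h5 : 5 ≤ i) (h12 : i ≤ 12) :
    IsAperiodic (wangShift (tileSet i)) ∧ IsMinimalSubshift (wangShift (tileSet i)) := by
  interval_cases i
  · exact isAperiodicMinimal5.wangShift (by simp [tileSet, tiles5, tileList5])
  · exact isAperiodicMinimal6.wangShift (by simp [tileSet, tiles6, tileList6])
  · exact isAperiodicMinimal7.wangShift (by simp [tileSet, tiles7, tileList7])
  · exact isAperiodicMinimal8.wangShift (by simp [tileSet, tiles8, tileList8])
  · exact isAperiodicMinimal9.wangShift (by simp [tileSet, tiles9, tileList9])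
  · exact isAperiodicMinimal10.wangShift (by simp [tileSet, tiles10, tileList10])
  · exact isAperiodicMinimal11.wangShift (by simp [tileSet, tiles11, tileList11])
  · exact isAperiodicMinimal12.wangShift (by simp [tileSet, tiles12, tileList12])
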